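/- Let $N,M\ge 0$, let $X^1_0,\dots,X^N_0,Y^1_0,\dots,Y^M_0$ be distinct real numbers, and let $S\subset\mathbb R^{N+M}$ be the set of points $(x_1,\dots,x_N,y_1,\dots,y_M)$ ordered on the real line in the same way as $(X^1_0,\dots,Y^M_0)$. Let $\mathcal F=C^\infty(S\to\mathbb C)[f_{-2},f_{-3},\dots]$ be the algebra of polynomials in the variables $f_{-2},f_{-3},\dots$ with coefficients in $C^\infty(S\to\mathbb C)$. Put $f(u)=u+\sum_{m\le-2}f_mu^{1+m}$, a formal Laurent series in $u^{-1}$, let $Sf=\frac{f'''}{f'}-\frac32\big(\frac{f''}{f'}\big)^2$, and let $\operatorname{Res}_u$ denote the coefficient of $u^{-1}$. Below, $\frac1{(f(u)-x)^j}$ is expanded for $|f(u)|>|x|$ and $\frac{1}{f(z)-f(u)}$ for $|f(z)|>|f(u)|$. Let $\kappa>0$, $\kappa_I\in\{\kappa,16/\kappa\}$ and $h_{x_I}=\frac{6-\kappa_I}{2\kappa_I}$ for $I=1,\dots,N$, let $h_{y_1},\dots,h_{y_M}\in\mathbb R$, and let $c=\frac{(6-\kappa)(3\kappa-8)}{2\kappa}$.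 For $n\in\mathbb Z$ define the operator on $\mathcal F$ $$\mathcal L_n=\operatorname{Res}_u u^{1-n}\Big\{\frac{c}{12}Sf(u)-\sum_{l\le-2}\operatorname{Res}_z\frac{f'(u)^2z^{-2-l}}{f(z)-f(u)}\frac{\partial}{\partial f_l}+\sum_{I=1}^N f'(u)^2\Big(\frac{h_{x_I}}{(f(u)-x_I)^2}+\frac1{f(u)-x_I}\frac{\partial}{\partial x_I}\Big)+\sum_{K=1}^M f'(u)^2\Big(\frac{h_{y_K}}{(f(u)-y_K)^2}+\frac1{f(u)-y_K}\frac{\partial}{\partial y_K}\Big)\Big\},$$ and for $I=1,\dots,N$ the operator on $\mathcal F$ $$\mathcal A_I=\frac{\kappa_I}{2}\frac{\partial^2}{\partial x_I^2}+\sum_{J\ne I}\Big(\frac{2}{x_J-x_I}\frac{\partial}{\partial x_J}+\frac{(\kappa_J-6)/\kappa_J}{(x_J-x_I)^2}\Big)+\sum_{K=1}^M\Big(\frac{2}{y_K-x_I}\frac{\partial}{\partial y_K}-\frac{2h_{y_K}}{(y_K-x_I)^2}\Big)+2\sum_{m\le-2}\Big(\operatorname{Res}_v\frac{v^{-2-m}}{f(v)-x_I}\Big)\frac{\partial}{\partial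 f_m}.$$ Then there are polynomials $q_n(x;f_{-2},f_{-3},\dots)$, $n\in\mathbb Z$, with complex coefficients, which do not depend on any of the above data, such that $q_n$ is homogeneous of degree $-n$ when $x$ has degree $1$ and $f_m$ has degree $-m$, such that $q_n=0$ for $n>0$, and such that $$[\mathcal L_n,\mathcal A_I]=q_n(x_I;f_{-2},f_{-3},\dots)\,\mathcal A_I\qquad\text{for all } n\in\mathbb Z,\ I=1,\dots,N.$$ In particular, if $\mathcal A_I\eta=0$, then $\mathcal A_I\mathcal L_n\eta=0$. The operators $\mathcal L_n$ make $\mathcal F$ a module over the Virasoro algebra with central charge $c$, that is, $[\mathcal L_n,\mathcal L_m]=(n-m)\mathcal L_{n+m}+\frac c{12}(n^3-n)\delta_{n+m,0}$, and $\bigcap_I\ker\mathcal A_I$ is a Virasoro submodule of $\mathcal F$. -/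

import Mathlib

namespace SLE

noncomputable section

open scoped ContDiff

/-! ### Formal Laurent series at infinity

`R((u⁻¹))` is realised as `LaurentSeries R` in the variable `X = u⁻¹`. So the coefficient of `u ^ k`
is the coefficient of `X ^ (-k)`. -/

section Formal

variable {R : Type*} [CommRing R]

/-- The monomial `u ^ k`. -/
def upow (R : Type*) [CommRing R] (k : ℤ) : LaurentSeries R := HahnSeries.single (-k) 1

/-- The formal residue, i.e. the coefficient of `u ^ (-1)`. -/
def res (s : LaurentSeries R) : R := s.coeff 1

/-- The formal derivative `d/du = -X² d/dX`, where `X = u⁻¹`. -/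
def ddu (s : LaurentSeries R) : LaurentSeries R :=
  -(upow R (-2) * LaurentSeries.derivative R s)

/-- The series `f(u) = u + ∑_{m ≤ -2} f_m u ^ (1 + m)`, where `a k = f_{-2-k}` for `k : ℕ`. -/
def fSeries (a : ℕ → R) : LaurentSeries R :=
  upow R 1 + HahnSeries.ofPowerSeries ℤ R (PowerSeries.X * PowerSeries.mk a)

/-- The expansion `(1 / (f(u) - b))_{|f(u)| > |b|} = ∑_{m ≥ 0} b ^ m f(u) ^ (-1-m)`: it is the
inverse of `f(u) - b` in the ring `R((u⁻¹))`. That `f(u) - b` is invertible there is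
`isUnit_fSeries_sub`. -/
def fInv (a : ℕ → R) (b : R) : LaurentSeries R :=
  Ring.inverse (fSeries a - HahnSeries.C b)

/-- The expansion `(1 / (f(z) - f(u)))_{|f(z)| > |f(u)|}`, a series in `z⁻¹` whose coefficients are
Laurent series in `u⁻¹`. -/
def fInvTwo (a : ℕ → R) : LaurentSeries (LaurentSeries R) :=
  fInv (fun k => (HahnSeries.C (a k) : LaurentSeries R)) (fSeries a)

/-- The Schwarzian derivative `Sf = f''' / f' - (3/2) (f'' / f')²` of a series with invertible
derivative. -/
def schwarzian [Algebra ℂ R] (s : LaurentSeries R) : LaurentSeries R :=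
  ddu (ddu (ddu s)) * Ring.inverse (ddu s)
    - (3 / 2 : ℂ) • (ddu (ddu s) * Ring.inverse (ddu s)) ^ 2

theorem isUnit_fSeries_sub (a : ℕ → R) (b : R) : IsUnit (fSeries a - HahnSeries.C b) := by
  have h : upow R (-1) * (fSeries a - HahnSeries.C b) =
      HahnSeries.ofPowerSeries ℤ R
        (1 + PowerSeries.X * (PowerSeries.X * PowerSeries.mk a - PowerSeries.C b)) := by
    simp only [upow, fSeries, map_add, map_mul, map_sub, map_one, HahnSeries.ofPowerSeries_X,
      HahnSeries.ofPowerSeries_C, mul_sub, mul_add, HahnSeries.single_mul_single]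
    simp
    ring
  refine isUnit_of_mul_isUnit_right (x := upow R (-1)) ?_
  rw [h]
  exact (PowerSeries.isUnit_iff_constantCoeff.2 (by simp)).map _

theorem coeff_ddu (s : LaurentSeries R) (n : ℤ) :
    (ddu s).coeff n = -((n - 1) • s.coeff (n - 1)) := by
  rw [ddu, upow, HahnSeries.coeff_neg, neg_neg, HahnSeries.coeff_single_mul]
  simp [LaurentSeries.hasseDeriv_coeff, show n - 2 + 1 = n - 1 by ring]

theorem isUnit_ddu_fSeries (a : ℕ → R) : IsUnit (ddu (fSeries a)) := by
  apply HahnSeries.isUnit_of_orderTop_pos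
  have hs (k : ℤ) (hk : k ≤ -1) : (fSeries a).coeff k = if k = -1 then 1 else 0 := by
    have h0 : (HahnSeries.ofPowerSeries ℤ R (PowerSeries.X * PowerSeries.mk a)).coeff k = 0 := by
      rw [PowerSeries.coeff_coe, if_pos (by lia)]
    rw [fSeries, HahnSeries.coeff_add, h0, upow, HahnSeries.coeff_single, add_zero]
    split_ifs <;> rfl
  have h1 : ((1 : ℤ) : WithTop ℤ) ≤ (ddu (fSeries a) - 1).orderTop := by
    rw [HahnSeries.le_orderTop_iff_forall]
    intro j hj
    have hj' : j ≤ 0 := by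
      have := WithTop.coe_lt_coe.1 hj
      lia
    rw [HahnSeries.coeff_sub, coeff_ddu, hs _ (by lia), HahnSeries.coeff_one]
    by_cases h : j = 0
    · simp [h]
    · simp [h]
  exact lt_of_lt_of_le (by exact_mod_cast (zero_lt_one : (0 : ℤ) < 1)) h1

end Formal

/-! ### The space of functions of SLE data -/

section Functions

variable {N M : ℕ}

/-- The set `S` of points `(x_1, …, x_N, y_1, …, y_M)` whose coordinates are ordered on the real
line in the same way as those of `p₀`. -/
def orderedSet (p₀ : Fin N ⊕ Fin M → ℝ) : Set (Fin N ⊕ Fin M → ℝ) :=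
  {p | ∀ i j, p i < p j ↔ p₀ i < p₀ j}

variable {p₀ : Fin N ⊕ Fin M → ℝ}

/-- Extension by zero of a function on `S`. -/
def extendZero (φ : orderedSet p₀ → ℂ) : (Fin N ⊕ Fin M → ℝ) → ℂ :=
  Function.extend Subtype.val φ 0

theorem extendZero_apply (φ : orderedSet p₀ → ℂ) {p : Fin N ⊕ Fin M → ℝ}
    (hp : p ∈ orderedSet p₀) : extendZero φ p = φ ⟨p, hp⟩ :=
  Subtype.val_injective.extend_apply φ 0 ⟨p, hp⟩

/-- The algebra `C^∞(S → ℂ)`. -/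
def Smooth (p₀ : Fin N ⊕ Fin M → ℝ) : Subalgebra ℂ (orderedSet p₀ → ℂ) where
  carrier := {φ | ContDiffOn ℝ ∞ (extendZero φ) (orderedSet p₀)}
  mul_mem' {φ ψ} hφ hψ := by
    refine (ContDiffOn.mul hφ hψ).congr fun p hp => ?_
    simp [extendZero_apply _ hp]
  add_mem' {φ ψ} hφ hψ := by
    refine (ContDiffOn.add hφ hψ).congr fun p hp => ?_
    simp [extendZero_apply _ hp]
  algebraMap_mem' c := by
    refine (contDiffOn_const (c := c)).congr fun p hp => ?_
    simp [extendZero_apply _ hp]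

theorem injective_of_mem (hp₀ : Function.Injective p₀) {p : Fin N ⊕ Fin M → ℝ}
    (hp : p ∈ orderedSet p₀) : Function.Injective p := by
  intro i j hij
  by_contra hne
  rcases lt_or_gt_of_ne (hp₀.ne hne) with h | h
  · exact absurd ((hp i j).2 h) (by simp [hij])
  · exact absurd ((hp j i).2 h) (by simp [hij])

theorem isOpen_orderedSet (hp₀ : Function.Injective p₀) : IsOpen (orderedSet p₀) := by
  have : orderedSet p₀ = ⋂ i, ⋂ j, {p | p₀ i < p₀ j → p i < p j} := by
    ext p
    simp only [orderedSet, Set.mem_ofPred_eq, Set.mem_iInter]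
    refine ⟨fun h i j => (h i j).2, fun h i j => ⟨fun hij => ?_, h i j⟩⟩
    by_contra hc
    rcases (not_lt.1 hc).lt_or_eq with h1 | h1
    · exact lt_asymm hij (h j i h1)
    · rw [hp₀ h1] at hij
      exact lt_irrefl _ hij
  rw [this]
  refine isOpen_iInter_of_finite fun i => isOpen_iInter_of_finite fun j => ?_
  by_cases h : p₀ i < p₀ j
  · simpa [h] using isOpen_lt (continuous_apply i) (continuous_apply j)
  · simp [h]

/-- The coordinate function `p ↦ p i`. -/
def coord (p₀ : Fin N ⊕ Fin M → ℝ) (i : Fin N ⊕ Fin M) : Smooth p₀ :=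
  ⟨fun p => ((p.1 i : ℝ) : ℂ), by
    have h : ContDiff ℝ ∞ fun p : Fin N ⊕ Fin M → ℝ => ((p i : ℝ) : ℂ) :=
      Complex.ofRealCLM.contDiff.comp (contDiff_apply ℝ ℝ i)
    exact h.contDiffOn.congr fun p hp => extendZero_apply _ hp⟩

/-- The function `p ↦ 1 / (p j - p i)` on `S`; it is used only for `i ≠ j`. -/
def invDiff (hp₀ : Function.Injective p₀) (i j : Fin N ⊕ Fin M) : Smooth p₀ :=
  ⟨fun p => ((p.1 j : ℂ) - (p.1 i : ℂ))⁻¹, by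
    have h : ContDiff ℝ ∞ fun p : Fin N ⊕ Fin M → ℝ => ((p j : ℝ) : ℂ) - ((p i : ℝ) : ℂ) :=
      (Complex.ofRealCLM.contDiff.comp (contDiff_apply ℝ ℝ j)).sub
        (Complex.ofRealCLM.contDiff.comp (contDiff_apply ℝ ℝ i))
    by_cases hij : i = j
    · subst hij
      refine (contDiffOn_const (c := (0 : ℂ))).congr fun p hp => ?_
      simp [extendZero_apply _ hp]
    · refine (h.contDiffOn.inv fun p hp => ?_).congr fun p hp => extendZero_apply _ hp
      rw [sub_ne_zero]
      exact_mod_cast fun h' => hij (injective_of_mem hp₀ hp h').symm⟩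

/-- The partial derivative with respect to the `i`-th coordinate, on `C^∞(S → ℂ)`. -/
def partialDeriv (hp₀ : Function.Injective p₀) (i : Fin N ⊕ Fin M) :
    Smooth p₀ →ₗ[ℂ] Smooth p₀ where
  toFun φ := ⟨fun p => fderiv ℝ (extendZero φ.1) p.1 (Pi.single i 1), by
    have h : ContDiffOn ℝ ∞ (fderiv ℝ (extendZero φ.1)) (orderedSet p₀) :=
      ContDiffOn.fderiv_of_isOpen φ.2 (isOpen_orderedSet hp₀) (by simp)
    exact (h.clm_apply contDiffOn_const).congr fun p hp => extendZero_apply _ hp⟩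
  map_add' φ ψ := by
    ext p
    have hd (χ : Smooth p₀) : DifferentiableAt ℝ (extendZero χ.1) p.1 :=
      (ContDiffOn.contDiffAt χ.2 ((isOpen_orderedSet hp₀).mem_nhds p.2)).differentiableAt
        (by simp)
    have he : extendZero (φ + ψ).1 =ᶠ[nhds p.1] extendZero φ.1 + extendZero ψ.1 := by
      filter_upwards [(isOpen_orderedSet hp₀).mem_nhds p.2] with x hx
      simp [extendZero_apply _ hx]
    simp only [he.fderiv_eq, fderiv_add (hd φ) (hd ψ)]
    rfl
  map_smul' c φ := by
    ext p
    have hd : DifferentiableAt ℝ (extendZero φ.1) p.1 :=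
      (ContDiffOn.contDiffAt φ.2 ((isOpen_orderedSet hp₀).mem_nhds p.2)).differentiableAt
        (by simp)
    have he : extendZero (c • φ).1 =ᶠ[nhds p.1] c • extendZero φ.1 := by
      filter_upwards [(isOpen_orderedSet hp₀).mem_nhds p.2] with x hx
      simp [extendZero_apply _ hx]
    simp only [he.fderiv_eq, fderiv_const_smul hd]
    rfl

/-- The space `ℱ = C^∞(S → ℂ)[f_{-2}, f_{-3}, …]`; the variable `X k` is `f_{-2-k}`. -/
def SLEData (p₀ : Fin N ⊕ Fin M → ℝ) : Type := MvPolynomial ℕ (Smooth p₀)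

instance (p₀ : Fin N ⊕ Fin M → ℝ) : CommRing (SLEData p₀) :=
  inferInstanceAs (CommRing (MvPolynomial ℕ (Smooth p₀)))

instance (p₀ : Fin N ⊕ Fin M → ℝ) : Algebra ℂ (SLEData p₀) :=
  inferInstanceAs (Algebra ℂ (MvPolynomial ℕ (Smooth p₀)))

/-- Multiplication by an element of `ℱ`. -/
def mulOp (η : SLEData p₀) : Module.End ℂ (SLEData p₀) := LinearMap.mulLeft ℂ η

/-- An element of `C^∞(S → ℂ)` as an element of `ℱ`. -/
def const (φ : Smooth p₀) : SLEData p₀ := (MvPolynomial.C φ : MvPolynomial ℕ (Smooth p₀))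

/-- The variables `f_{-2}, f_{-3}, …` of `ℱ`. -/
def fVar (p₀ : Fin N ⊕ Fin M → ℝ) (k : ℕ) : SLEData p₀ :=
  (MvPolynomial.X k : MvPolynomial ℕ (Smooth p₀))

/-- The partial derivative with respect to the `i`-th coordinate, acting on `ℱ` coefficientwise. -/
def dX (hp₀ : Function.Injective p₀) (i : Fin N ⊕ Fin M) : Module.End ℂ (SLEData p₀) :=
  let e : MvPolynomial ℕ (Smooth p₀) ≃ₗ[ℂ] ((ℕ →₀ ℕ) →₀ Smooth p₀) :=
    AddMonoidAlgebra.coeffLinearEquiv ℂ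
  let d : MvPolynomial ℕ (Smooth p₀) →ₗ[ℂ] MvPolynomial ℕ (Smooth p₀) :=
    e.symm.toLinearMap ∘ₗ Finsupp.mapRange.linearMap (partialDeriv hp₀ i) ∘ₗ e.toLinearMap
  d

/-- The operator `∑_{m ≤ -2} b_m ∂/∂f_m` on `ℱ`, where `b k` stands for `b_{-2-k}`: the derivation
over `C^∞(S → ℂ)` which sends the variable `f_m` to `b_m`. -/
def dF (b : ℕ → SLEData p₀) : Module.End ℂ (SLEData p₀) :=
  let D : Derivation (Smooth p₀) (MvPolynomial ℕ (Smooth p₀)) (MvPolynomial ℕ (Smooth p₀)) :=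
    MvPolynomial.mkDerivation (Smooth p₀) b
  D.toLinearMap.restrictScalars ℂ

/-- The series `f(u)` whose coefficients are the variables `f_{-2}, f_{-3}, …` of `ℱ`. -/
def fGen (p₀ : Fin N ⊕ Fin M → ℝ) : LaurentSeries (SLEData p₀) := fSeries (fVar p₀)

/-- The series `(1 / (f(u) - p_i))_{|f(u)| > |p_i|}` for the `i`-th coordinate `p_i`. -/
def fGenInv (p₀ : Fin N ⊕ Fin M → ℝ) (i : Fin N ⊕ Fin M) : LaurentSeries (SLEData p₀) :=
  fInv (fVar p₀) (const (coord p₀ i))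

/-! ### The operators -/

/-- The operator `ℒ_n` on `ℱ` with parameters `c` and `δ`:
`Res_u u^(1-n) { (c/12) Sf(u)
  - ∑_{l ≤ -2} Res_z f'(u)² z^(-2-l) (1 / (f(z) - f(u)))_{|f(z)| > |f(u)|} ∂/∂f_l
  + ∑_i f'(u)² ( δ_i / (f(u) - p_i)² + 1 / (f(u) - p_i) ∂/∂p_i ) }`,
where `p_i` runs over all of `x_1, …, x_N, y_1, …, y_M`. -/
def virL (hp₀ : Function.Injective p₀) (c : ℂ) (δ : Fin N ⊕ Fin M → ℂ) (n : ℤ) :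
    Module.End ℂ (SLEData p₀) :=
  mulOp (p₀ := p₀) (res (upow (SLEData p₀) (1 - n) * ((c / 12) • schwarzian (fGen p₀))))
  - dF (p₀ := p₀) (fun k => res (upow (SLEData p₀) (1 - n) *
      (ddu (fGen p₀) ^ 2 * res (upow _ (k : ℤ) * fInvTwo (fVar p₀)))))
  + ∑ i : Fin N ⊕ Fin M,
      (δ i • mulOp (p₀ := p₀) (res (upow (SLEData p₀) (1 - n) * (ddu (fGen p₀) ^ 2 * fGenInv p₀ i ^ 2)))
        + mulOp (p₀ := p₀) (res (upow (SLEData p₀) (1 - n) * (ddu (fGen p₀) ^ 2 * fGenInv p₀ i))) * dX hp₀ i)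

/-- The null field operator
`𝒟_I = (κ_I/2) ∂²/∂x_I² + ∑_{J ≠ I} (2/(x_J - x_I) ∂/∂x_J + ((κ_J - 6)/κ_J)/(x_J - x_I)²)
  + ∑_K (2/(y_K - x_I) ∂/∂y_K - 2 h_K/(y_K - x_I)²)`. -/
def nullD (hp₀ : Function.Injective p₀) (κ : Fin N → ℝ) (h : Fin M → ℝ) (I : Fin N) :
    Module.End ℂ (SLEData p₀) :=
  ((κ I / 2 : ℝ) : ℂ) • dX hp₀ (Sum.inl I) ^ 2
  + ∑ J ∈ Finset.univ.erase I,
      (mulOp (p₀ := p₀) (const (2 * invDiff hp₀ (Sum.inl I) (Sum.inl J))) * dX hp₀ (Sum.inl J)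
        + (((κ J - 6) / κ J : ℝ) : ℂ) •
            mulOp (p₀ := p₀) (const (invDiff hp₀ (Sum.inl I) (Sum.inl J) ^ 2)))
  + ∑ K : Fin M,
      (mulOp (p₀ := p₀) (const (2 * invDiff hp₀ (Sum.inl I) (Sum.inr K))) * dX hp₀ (Sum.inr K)
        - ((2 * h K : ℝ) : ℂ) • mulOp (p₀ := p₀) (const (invDiff hp₀ (Sum.inl I) (Sum.inr K) ^ 2)))

/-- The operator `𝒜_I = 𝒟_I + 2 ∑_{m ≤ -2} p_m(-x_I, f_{-2}, …) ∂/∂f_m`, where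
`p_m(-x_I, f_{-2}, …) = Res_v v^(-2-m) (1 / (f(v) - x_I))_{|f(v)| > |x_I|}`. -/
def driftA (hp₀ : Function.Injective p₀) (κ : Fin N → ℝ) (h : Fin M → ℝ) (I : Fin N) :
    Module.End ℂ (SLEData p₀) :=
  nullD hp₀ κ h I
  + (2 : ℂ) • dF (p₀ := p₀) (fun k => res (upow (SLEData p₀) (k : ℤ) * fGenInv p₀ (Sum.inl I)))

end Functions

/-- The conformal weight `h_{x_I} = (6 - κ_I) / (2 κ_I)`. -/
def weightX (κ : ℝ) : ℝ := (6 - κ) / (2 * κ)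

/-- The central charge `c(κ) = (6 - κ)(3κ - 8) / (2κ)`. -/
def centralCharge (κ : ℝ) : ℝ := (6 - κ) * (3 * κ - 8) / (2 * κ)

/-- The operators `L n` satisfy the commutation relations of the Virasoro algebra, the central
element acting as multiplication by `c`. -/
def IsVirasoroRep {V : Type*} [AddCommGroup V] [Module ℂ V] (c : ℂ)
    (L : ℤ → Module.End ℂ V) : Prop :=
  ∀ n m : ℤ, ⁅L n, L m⁆ =
    ((n : ℂ) - m) • L (n + m)
      + (if n + m = 0 then c / 12 * ((n : ℂ) ^ 3 - n) else 0) • (1 : Module.End ℂ V)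

/-- Degrees of the variables of a polynomial in `x, f_{-2}, f_{-3}, …`: the variable `none` is `x`,
of degree `1`, and `some k` is `f_{-2-k}`, of degree `k + 2`. -/
def varDegree : Option ℕ → ℤ
  | none => 1
  | some k => k + 2

/-- The element `q(x_I; f_{-2}, f_{-3}, …)` of `ℱ`, for a polynomial `q` in
`x, f_{-2}, f_{-3}, …`. -/
def evalAt {N M : ℕ} (p₀ : Fin N ⊕ Fin M → ℝ) (I : Fin N) (q : MvPolynomial (Option ℕ) ℂ) :
    SLEData p₀ :=
  MvPolynomial.aeval
    (fun o : Option ℕ => o.elim (const (coord p₀ (Sum.inl I))) (fVar p₀)) q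

end

end SLE

namespace SLE

noncomputable section

open scoped ContDiff

/-! ### Laurent series vanishing below a given degree -/

section Vanishing

variable {R : Type*} [CommRing R]

/-! Write ℒ_n = D_n + ρ_n and 𝒜_I = (κ_I/2) P² + W + m, where P = ∂/∂x_I, D_n and W are vector
fields on the space of variables (p_i, f_m), and ρ_n, m are functions. Everything is governed by one
polynomial v_n, the polynomial part of u^(1-n) f'(u) expanded in powers of f. Its value is v_n(b) =
Res_u u^(1-n) f'(u)²/(f(u)-b) (`eval_vPoly`), and D_n acts by p_i ↦ v_n(p_i) and f(u) ↦ v_n(f(u)) -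
u^(1-n) f'(u) (`coeff_vRem`). The function ρ_n is (c/12) Res u^(1-n) Sf + ∑ δ_i v_n'(p_i). The field
W is the Loewner flow p_i ↦ 2/(p_i-x), f ↦ 2/(f-x), which fixes x = x_I.

The bracket identities rest on a uniqueness principle, `eq_zero_of_vanishesBelow_polyF`: a
polynomial p with p(f(u)) = O(u⁻¹) is zero. A derivation acting on coefficients keeps series of size
O(u⁻¹), so when a bracket applied to f(u) is computed, the polynomial discrepancy must vanish. This
gives [D_n, D_m] = (n-m) D_{n+m} (`polyD_vPoly_sub`), that P annihilates the coefficients of v_n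
(`polyD_vPoly_of_eq_zero`), and an explicit formula for the action of W on these coefficients
(`onCoeff_loewner_sub_and`). From the latter, [D_n, W] = -2v_n'(x) W + 3v_n''(x) P.

The Schwarzian is handled by the operator τ ↦ τ''' + 2Sf τ' + (Sf)'τ, which gives the variation of
Sf under δf = τ f' (`onCoeff_schwarzian`). It is antisymmetric for the residue pairing
(`res_mul_bol`) and becomes the plain third derivative in the coordinate f (`bol_comp`). This
produces the central term (`apply_res_schwarzian_sub`) and W Res u^(1-n) Sf = -2v_n'''(x).

Finally [ℒ_n, 𝒜_I] is compared with -2v_n'(x) 𝒜_I order by order (`commutator_eq_mul`). The P² and W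
terms agree at once, the P terms agree because (κ_I/2)(1 + 2h) = 3, and the functions agree because
c = h(3κ_I - 8), where h = h_{x_I}. Hence q_n = -2v_n'(x), which is a universal polynomial. One c
serves all I since it is invariant under κ ↦ 16/κ. -/

/-- The coefficients of `s` of degree less than `N` in `u⁻¹` vanish. -/
def VanishesBelow (N : ℤ) (s : LaurentSeries R) : Prop := ∀ k < N, s.coeff k = 0

namespace VanishesBelow

variable {N M : ℤ} {s t : LaurentSeries R}

theorem mono (h : VanishesBelow N s) (hM : M ≤ N) : VanishesBelow M s :=
  fun k hk => h k (lt_of_lt_of_le hk hM)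

theorem add (hs : VanishesBelow N s) (ht : VanishesBelow N t) : VanishesBelow N (s + t) :=
  fun k hk => by rw [HahnSeries.coeff_add, hs k hk, ht k hk, add_zero]

theorem sub (hs : VanishesBelow N s) (ht : VanishesBelow N t) : VanishesBelow N (s - t) :=
  fun k hk => by rw [HahnSeries.coeff_sub, hs k hk, ht k hk, sub_zero]

theorem zero : VanishesBelow N (0 : LaurentSeries R) := fun _ _ => rfl

theorem one : VanishesBelow 0 (1 : LaurentSeries R) := fun k hk => by
  rw [HahnSeries.coeff_one, if_neg hk.ne]

theorem const (r : R) : VanishesBelow 0 (HahnSeries.C r : LaurentSeries R) := fun k hk => by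
  rw [HahnSeries.C_apply, HahnSeries.coeff_single, if_neg hk.ne]

theorem mul (hs : VanishesBelow N s) (ht : VanishesBelow M t) :
    VanishesBelow (N + M) (s * t) := by
  intro k hk
  rw [HahnSeries.coeff_mul]
  refine Finset.sum_eq_zero fun ij hij => ?_
  have h3 := (Finset.mem_antidiagonal.1 hij).2.2
  rcases lt_or_ge ij.1 N with h | h
  · rw [hs _ h, zero_mul]
  · rw [ht _ (by lia), mul_zero]

theorem coeff_mul (hs : VanishesBelow N s) (ht : VanishesBelow M t) :
    (s * t).coeff (N + M) = s.coeff N * t.coeff M := by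
  rw [HahnSeries.coeff_mul]
  refine Finset.sum_eq_single (N, M) (fun ij hij hne => ?_) fun hne => ?_
  · have h3 := (Finset.mem_antidiagonal.1 hij).2.2
    rcases lt_trichotomy ij.1 N with h | h | h
    · rw [hs _ h, zero_mul]
    · exact absurd (Prod.ext h (by simp only; lia)) hne
    · rw [ht _ (by lia), mul_zero]
  · by_contra hc
    exact hne (Finset.mem_antidiagonal.2 ⟨left_ne_zero_of_mul hc, right_ne_zero_of_mul hc, rfl⟩)

theorem pow (hs : VanishesBelow N s) (n : ℕ) : VanishesBelow (n * N) (s ^ n) := by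
  induction n with
  | zero => simpa using one
  | succ n ih =>
    rw [pow_succ]
    exact (ih.mul hs).mono (by push_cast; ring_nf; rfl)

theorem const_mul (hs : VanishesBelow N s) (r : R) : VanishesBelow N (HahnSeries.C r * s) := by
  simpa using (const r).mul hs

theorem ddu (hs : VanishesBelow N s) : VanishesBelow (N + 1) (ddu s) := fun k hk => by
  rw [coeff_ddu, hs _ (by lia), smul_zero, neg_zero]

theorem res_eq_zero (hs : VanishesBelow N s) (hN : 2 ≤ N) : res s = 0 := hs 1 (by lia)

end VanishesBelow

theorem exists_vanishesBelow (s : LaurentSeries R) : ∃ N, VanishesBelow N s :=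
  ⟨s.order, fun _ hk => HahnSeries.coeff_eq_zero_of_lt_order hk⟩

theorem vanishesBelow_upow (k : ℤ) : VanishesBelow (-k) (upow R k) := fun j hj => by
  rw [upow, HahnSeries.coeff_single, if_neg hj.ne]

theorem upow_add (j k : ℤ) : upow R (j + k) = upow R j * upow R k := by
  rw [upow, upow, upow, HahnSeries.single_mul_single, neg_add, one_mul]

theorem upow_zero : upow R 0 = 1 := by rw [upow, neg_zero]; rfl

theorem coeff_upow_mul (k j : ℤ) (s : LaurentSeries R) :
    (upow R k * s).coeff j = s.coeff (j + k) := by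
  rw [upow, HahnSeries.coeff_single_mul, one_mul, sub_neg_eq_add]

theorem res_upow_mul (k : ℤ) (s : LaurentSeries R) : res (upow R k * s) = s.coeff (k + 1) := by
  rw [res, coeff_upow_mul, add_comm]

theorem res_add (s t : LaurentSeries R) : res (s + t) = res s + res t := rfl
theorem res_sub (s t : LaurentSeries R) : res (s - t) = res s - res t := rfl
theorem res_zero : res (0 : LaurentSeries R) = 0 := rfl

theorem res_sum {ι : Type*} (S : Finset ι) (F : ι → LaurentSeries R) :
    res (∑ i ∈ S, F i) = ∑ i ∈ S, res (F i) := by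
  classical
  induction S using Finset.induction_on with
  | empty => rfl
  | insert i S hi ih => rw [Finset.sum_insert hi, Finset.sum_insert hi, res_add, ih]

theorem res_const_mul (r : R) (s : LaurentSeries R) : res (HahnSeries.C r * s) = r * res s := by
  rw [res, res, HahnSeries.C_apply, HahnSeries.coeff_single_zero_mul]

end Vanishing

/-! ### Derivations of rings of Laurent series -/

section Derivations

variable {R : Type*} [CommRing R]

theorem ddu_add (s t : LaurentSeries R) : ddu (s + t) = ddu s + ddu t := by
  simp only [ddu, map_add, mul_add, neg_add]

/-- The Euler operator u d/du is diagonal on monomials, so its Leibniz rule is additivity of degrees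
in the convolution product. The rule for d/du follows because u is invertible. -/
theorem ddu_mul (s t : LaurentSeries R) : ddu (s * t) = s * ddu t + t * ddu s := by
  ext n
  let θ : LaurentSeries R → LaurentSeries R := fun s => upow R 1 * ddu s
  have hθ (s : LaurentSeries R) (k : ℤ) : (θ s).coeff k = -(k • s.coeff k) := by
    simp only [θ]
    rw [coeff_upow_mul, coeff_ddu, add_sub_cancel_right]
  have hsub (s : LaurentSeries R) : (θ s).support ⊆ s.support := fun k hk hk0 =>
    hk (by rw [hθ, hk0, smul_zero, neg_zero])
  have key : (upow R 1 * ddu (s * t)) = upow R 1 * (s * ddu t + t * ddu s) := by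
    have : upow R 1 * (s * ddu t + t * ddu s) = s * θ t + θ s * t := by simp only [θ]; ring
    rw [this]
    ext k
    change (θ (s * t)).coeff k = _
    -- The Euler operator does not enlarge supports, so all three convolutions can be written over
    -- one antidiagonal and compared term by term.
    rw [hθ, HahnSeries.coeff_add, HahnSeries.coeff_mul,
      HahnSeries.coeff_mul_right' t.isPWO_support (hsub t),
      HahnSeries.coeff_mul_left' s.isPWO_support (hsub s), Finset.smul_sum,
      ← Finset.sum_neg_distrib, ← Finset.sum_add_distrib]
    refine Finset.sum_congr rfl fun ij hij => ?_
    have h3 := (Finset.mem_antidiagonal.1 hij).2.2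
    rw [hθ, hθ, ← h3]
    simp only [zsmul_eq_mul]
    push_cast
    ring
  have := congrArg (fun s => (upow R (-1) * s).coeff n) key
  simpa only [← mul_assoc, ← upow_add, neg_add_cancel, upow_zero, one_mul] using this

/-- The formal derivative as an additive map. -/
def dduHom (R : Type*) [CommRing R] : LaurentSeries R →+ LaurentSeries R :=
  AddMonoidHom.mk' ddu ddu_add

theorem ddu_neg (s : LaurentSeries R) : ddu (-s) = -ddu s := map_neg (dduHom R) s
theorem ddu_sub (s t : LaurentSeries R) : ddu (s - t) = ddu s - ddu t := map_sub (dduHom R) s t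

theorem ddu_C (r : R) : ddu (HahnSeries.C r : LaurentSeries R) = 0 := by
  ext n
  rw [coeff_ddu, HahnSeries.C_apply, HahnSeries.coeff_single]
  split_ifs with h
  · simp [h]
  · simp

theorem ddu_one : ddu (1 : LaurentSeries R) = 0 := by
  rw [← map_one (HahnSeries.C : R →+* LaurentSeries R), ddu_C]

theorem ddu_upow (k : ℤ) : ddu (upow R k) = HahnSeries.C (k : R) * upow R (k - 1) := by
  ext n
  rw [coeff_ddu, upow, upow, HahnSeries.C_apply, HahnSeries.coeff_single_zero_mul,
    HahnSeries.coeff_single, HahnSeries.coeff_single]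
  by_cases h : n - 1 = -k
  · rw [if_pos h, if_pos (by lia), h]; simp
  · rw [if_neg h, if_neg (by lia)]; simp

theorem ddu_zero : ddu (0 : LaurentSeries R) = 0 := map_zero (dduHom R)

theorem ddu_two : ddu (2 : LaurentSeries R) = 0 := by
  rw [← map_ofNat (HahnSeries.C : R →+* LaurentSeries R) 2, ddu_C]

theorem ddu_three : ddu (3 : LaurentSeries R) = 0 := by
  rw [← map_ofNat (HahnSeries.C : R →+* LaurentSeries R) 3, ddu_C]

theorem res_ddu (s : LaurentSeries R) : res (ddu s) = 0 := by
  rw [res, coeff_ddu]; simp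

theorem coeff_fSeries_natCast_add_one (a : ℕ → R) (k : ℕ) :
    (fSeries a).coeff (k + 1) = a k := by
  have : ((k : ℤ) + 1) = ((k + 1 : ℕ) : ℤ) := by push_cast; rfl
  rw [fSeries, HahnSeries.coeff_add, upow, HahnSeries.coeff_single, if_neg (by lia), zero_add, this,
    HahnSeries.ofPowerSeries_apply_coeff, PowerSeries.coeff_succ_X_mul, PowerSeries.coeff_mk]

variable [Algebra ℂ R]

/-- The action of a derivation on the coefficients of a Laurent series. -/
def onCoeff (E : Derivation ℂ R R) (s : LaurentSeries R) : LaurentSeries R :=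
  s.map E

theorem coeff_onCoeff (E : Derivation ℂ R R) (s : LaurentSeries R) (n : ℤ) :
    (onCoeff E s).coeff n = E (s.coeff n) := rfl

theorem onCoeff_add (E : Derivation ℂ R R) (s t : LaurentSeries R) :
    onCoeff E (s + t) = onCoeff E s + onCoeff E t := by
  ext n
  simp only [coeff_onCoeff, HahnSeries.coeff_add, map_add]

theorem onCoeff_mul (E : Derivation ℂ R R) (s t : LaurentSeries R) :
    onCoeff E (s * t) = s * onCoeff E t + t * onCoeff E s := by
  have hsub (s : LaurentSeries R) : (onCoeff E s).support ⊆ s.support := fun k hk hk0 =>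
    hk (by rw [coeff_onCoeff, hk0, map_zero])
  ext k
  rw [mul_comm t, HahnSeries.coeff_add, coeff_onCoeff, HahnSeries.coeff_mul,
    HahnSeries.coeff_mul_right' t.isPWO_support (hsub t),
    HahnSeries.coeff_mul_left' s.isPWO_support (hsub s), map_sum, ← Finset.sum_add_distrib]
  refine Finset.sum_congr rfl fun ij hij => ?_
  rw [Derivation.leibniz, coeff_onCoeff, coeff_onCoeff, smul_eq_mul, smul_eq_mul,
    mul_comm (t.coeff _)]

/-- The action of a derivation on the coefficients of Laurent series, as an additive map. -/
def onCoeffHom (E : Derivation ℂ R R) : LaurentSeries R →+ LaurentSeries R :=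
  AddMonoidHom.mk' (onCoeff E) (onCoeff_add E)

theorem onCoeff_sub (E : Derivation ℂ R R) (s t : LaurentSeries R) :
    onCoeff E (s - t) = onCoeff E s - onCoeff E t := map_sub (onCoeffHom E) s t
theorem onCoeff_C (E : Derivation ℂ R R) (r : R) :
    onCoeff E (HahnSeries.C r) = HahnSeries.C (E r) := by
  ext n
  rw [coeff_onCoeff, HahnSeries.C_apply, HahnSeries.C_apply, HahnSeries.coeff_single,
    HahnSeries.coeff_single]
  split_ifs <;> simp

theorem onCoeff_one (E : Derivation ℂ R R) : onCoeff E (1 : LaurentSeries R) = 0 := by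
  rw [← map_one (HahnSeries.C : R →+* LaurentSeries R), onCoeff_C, Derivation.map_one_eq_zero,
    map_zero]

theorem onCoeff_upow (E : Derivation ℂ R R) (k : ℤ) : onCoeff E (upow R k) = 0 := by
  ext n
  rw [coeff_onCoeff, upow, HahnSeries.coeff_single]
  split_ifs <;> simp

theorem onCoeff_two (E : Derivation ℂ R R) : onCoeff E (2 : LaurentSeries R) = 0 := by
  rw [← one_add_one_eq_two, onCoeff_add, onCoeff_one, add_zero]

theorem onCoeff_three (E : Derivation ℂ R R) : onCoeff E (3 : LaurentSeries R) = 0 := by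
  rw [← two_add_one_eq_three, onCoeff_add, onCoeff_two, onCoeff_one, add_zero]

theorem onCoeff_ddu (E : Derivation ℂ R R) (s : LaurentSeries R) :
    onCoeff E (ddu s) = ddu (onCoeff E s) := by
  ext n
  rw [coeff_onCoeff, coeff_ddu, coeff_ddu, map_neg, map_zsmul, coeff_onCoeff]

theorem res_onCoeff (E : Derivation ℂ R R) (s : LaurentSeries R) :
    res (onCoeff E s) = E (res s) := rfl

theorem VanishesBelow.onCoeff (E : Derivation ℂ R R) {N : ℤ} {s : LaurentSeries R}
    (hs : VanishesBelow N s) : VanishesBelow N (onCoeff E s) := fun k hk => by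
  rw [coeff_onCoeff, hs k hk, map_zero]

theorem onCoeff_fSeries (E : Derivation ℂ R R) (a : ℕ → R) (k : ℕ) :
    (onCoeff E (fSeries a)).coeff (k + 1) = E (a k) := by
  rw [coeff_onCoeff, coeff_fSeries_natCast_add_one]

end Derivations

/-! ### Powers of `f(u)` -/

section Powers

variable {R : Type*} [CommRing R]

/-- Orders need not be additive over a ring with zero divisors. With leading coefficient 1 in s, the
lowest coefficient of t is the lowest coefficient of the product, so the coefficients of t are
killed one at a time. -/
theorem VanishesBelow.of_mul {M Q : ℤ} {s t : LaurentSeries R} (hs : VanishesBelow M s)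
    (hs1 : s.coeff M = 1) (hst : VanishesBelow (M + Q) (s * t)) : VanishesBelow Q t := by
  obtain ⟨N₀, h0⟩ := exists_vanishesBelow t
  have key (i : ℕ) (hi : N₀ + i ≤ Q) : VanishesBelow (N₀ + i) t := by
    induction i with
    | zero => simpa using h0
    | succ i ih =>
      have h1 := ih (by push_cast at hi; lia)
      intro k hk
      rcases lt_or_ge k (N₀ + i) with h | h
      · exact h1 k h
      · have hk' : k = N₀ + i := by push_cast at hk; lia
        have h2 := hs.coeff_mul h1
        rw [hs1, one_mul] at h2
        rw [hk', ← h2]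
        exact hst _ (by push_cast at hi; lia)
  rcases le_or_gt Q N₀ with h | h
  · exact h0.mono h
  · have := key (Q - N₀).toNat (by lia)
    exact this.mono (by lia)

variable (a : ℕ → R)

theorem coeff_fSeries_of_neg {k : ℤ} (hk : k ≤ -1) :
    (fSeries a).coeff k = if k = -1 then 1 else 0 := by
  rw [fSeries, HahnSeries.coeff_add, PowerSeries.coeff_coe, if_pos (by lia), add_zero, upow,
    HahnSeries.coeff_single]
  split_ifs <;> rfl

theorem coeff_zero_fSeries : (fSeries a).coeff 0 = 0 := by
  rw [fSeries, HahnSeries.coeff_add, PowerSeries.coeff_coe, if_neg (by lia), upow,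
    HahnSeries.coeff_single, if_neg (by lia), zero_add]
  simp

theorem vanishesBelow_fSeries : VanishesBelow (-1) (fSeries a) := fun k hk => by
  rw [coeff_fSeries_of_neg a hk.le, if_neg hk.ne]

theorem vanishesBelow_ddu_fSeries : VanishesBelow 0 (ddu (fSeries a)) :=
  (vanishesBelow_fSeries a).ddu

theorem coeff_zero_ddu_fSeries : (ddu (fSeries a)).coeff 0 = 1 := by
  rw [coeff_ddu, coeff_fSeries_of_neg a (by lia)]; simp

theorem fSeries_sub_mul_fInv (b : R) : (fSeries a - HahnSeries.C b) * fInv a b = 1 :=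
  Ring.mul_inverse_cancel _ (isUnit_fSeries_sub a b)

theorem fSeries_mul_fInv (b : R) : fSeries a * fInv a b = 1 + HahnSeries.C b * fInv a b := by
  linear_combination fSeries_sub_mul_fInv a b

theorem fSeries_mul_fInv_zero : fSeries a * fInv a 0 = 1 := by
  rw [fSeries_mul_fInv, map_zero, zero_mul, add_zero]

theorem eq_fInv {b : R} {s : LaurentSeries R} (h : (fSeries a - HahnSeries.C b) * s = 1) :
    s = fInv a b := by
  linear_combination fInv a b * h - s * fSeries_sub_mul_fInv a b

theorem vanishesBelow_fInv (b : R) : VanishesBelow 1 (fInv a b) := by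
  refine VanishesBelow.of_mul (M := -1) (s := fSeries a - HahnSeries.C b) ?_ ?_ ?_
  · exact (vanishesBelow_fSeries a).sub ((VanishesBelow.const b).mono (by lia))
  · rw [HahnSeries.coeff_sub, coeff_fSeries_of_neg a le_rfl, HahnSeries.C_apply,
      HahnSeries.coeff_single, if_pos rfl, if_neg (by lia), sub_zero]
  · rw [fSeries_sub_mul_fInv]
    exact VanishesBelow.one

/-- `1 / f'(u)`. -/
def dduInv : LaurentSeries R := Ring.inverse (ddu (fSeries a))

theorem ddu_mul_dduInv : ddu (fSeries a) * dduInv a = 1 :=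
  Ring.mul_inverse_cancel _ (isUnit_ddu_fSeries a)

theorem vanishesBelow_dduInv : VanishesBelow 0 (dduInv a) := by
  refine (vanishesBelow_ddu_fSeries a).of_mul (coeff_zero_ddu_fSeries a) ?_
  rw [ddu_mul_dduInv]
  exact VanishesBelow.one

/-- `f(u)` as a unit of `R((u⁻¹))`. -/
def fUnit : (LaurentSeries R)ˣ where
  val := fSeries a
  inv := fInv a 0
  val_inv := fSeries_mul_fInv_zero a
  inv_val := by rw [mul_comm, fSeries_mul_fInv_zero]

/-- The powers `f(u) ^ j`, for `j : ℤ`. -/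
def fPow (j : ℤ) : LaurentSeries R := ((fUnit a ^ j : (LaurentSeries R)ˣ) : LaurentSeries R)

theorem fPow_add (i j : ℤ) : fPow a (i + j) = fPow a i * fPow a j := by
  rw [fPow, zpow_add]; rfl

theorem fPow_zero : fPow a 0 = 1 := by rw [fPow, zpow_zero]; rfl
theorem fPow_one : fPow a 1 = fSeries a := by rw [fPow, zpow_one]; rfl
theorem fPow_neg_one : fPow a (-1) = fInv a 0 := by rw [fPow, zpow_neg_one]; rfl

theorem fPow_natCast (m : ℕ) : fPow a m = fSeries a ^ m := by
  rw [fPow, zpow_natCast, Units.val_pow_eq_pow_val]; rfl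

theorem fPow_neg_natCast (m : ℕ) : fPow a (-m) = fInv a 0 ^ m := by
  rw [fPow, zpow_neg, ← inv_zpow, zpow_natCast, Units.val_pow_eq_pow_val]; rfl

theorem vanishesBelow_fPow (j : ℤ) : VanishesBelow (-j) (fPow a j) ∧ (fPow a j).coeff (-j) = 1 := by
  have step1 (i : ℤ) (h : VanishesBelow (-i) (fPow a i) ∧ (fPow a i).coeff (-i) = 1) :
      VanishesBelow (-(i + 1)) (fPow a (i + 1)) ∧ (fPow a (i + 1)).coeff (-(i + 1)) = 1 := by
    rw [fPow_add, fPow_one, neg_add]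
    refine ⟨h.1.mul (vanishesBelow_fSeries a), ?_⟩
    rw [h.1.coeff_mul (vanishesBelow_fSeries a), h.2, coeff_fSeries_of_neg a le_rfl, if_pos rfl,
      one_mul]
  have h1 : (fInv a 0).coeff 1 = 1 := by
    have := (vanishesBelow_fSeries a).coeff_mul (vanishesBelow_fInv a 0)
    rw [fSeries_mul_fInv_zero, coeff_fSeries_of_neg a le_rfl, if_pos rfl, one_mul] at this
    rw [← this, HahnSeries.coeff_one, if_pos (by lia)]
  induction j with
  | zero =>
    rw [fPow_zero, neg_zero]
    exact ⟨VanishesBelow.one, by rw [HahnSeries.coeff_one, if_pos rfl]⟩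
  | succ i ih => exact step1 _ ih
  | pred i ih =>
    rw [sub_eq_add_neg, fPow_add, fPow_neg_one, neg_add, neg_neg 1]
    refine ⟨ih.1.mul (vanishesBelow_fInv a 0), ?_⟩
    rw [ih.1.coeff_mul (vanishesBelow_fInv a 0), ih.2, h1, one_mul]

theorem ddu_fPow (j : ℤ) :
    ddu (fPow a j) = HahnSeries.C (j : R) * (fPow a (j - 1) * ddu (fSeries a)) := by
  have h0 : fSeries a * ddu (fInv a 0) + fInv a 0 * ddu (fSeries a) = 0 := by
    rw [← ddu_mul, fSeries_mul_fInv_zero, ddu_one]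
  have h1 := fSeries_mul_fInv_zero a
  have h2 : ddu (fInv a 0) = -(fInv a 0 ^ 2 * ddu (fSeries a)) := by
    linear_combination fInv a 0 * h0 - ddu (fInv a 0) * h1
  induction j with
  | zero => rw [fPow_zero, ddu_one]; simp
  | succ i ih =>
    have e : fPow a i = fPow a (i - 1) * fSeries a := by
      rw [← fPow_one, ← fPow_add, sub_add_cancel]
    rw [fPow_add, ddu_mul, ih, fPow_one, add_sub_cancel_right, e]
    push_cast
    rw [map_add, map_one]
    ring
  | pred i ih =>
    have e : fPow a (-i) = fPow a (-i - 1) * fSeries a := by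
      rw [← fPow_one, ← fPow_add, sub_add_cancel]
    have e' : fPow a (-i - 1 - 1) = fPow a (-i - 1) * fInv a 0 := by
      rw [← fPow_neg_one, ← fPow_add]; congr 1
    have e2 : fPow a (-i - 1) = fPow a (-i) * fInv a 0 := by
      rw [← fPow_neg_one, ← fPow_add]; congr 1
    rw [e', e2, ddu_mul, ih, e2, h2]
    push_cast
    rw [map_sub, map_neg, map_one]
    ring

theorem eq_zero_of_intCast_mul [Algebra ℂ R] {m : ℤ} (hm : m ≠ 0) {r : R} (h : (m : R) * r = 0) :
    r = 0 := by
  have e : algebraMap ℂ R (m : ℂ)⁻¹ * (m : R) = 1 := by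
    rw [← map_intCast (algebraMap ℂ R), ← map_mul, inv_mul_cancel₀ (by exact_mod_cast hm), map_one]
  linear_combination algebraMap ℂ R (m : ℂ)⁻¹ * h - r * e

/-- For j ≠ -1 the series f' f^j is, up to the invertible factor j + 1, the derivative of f^(j+1),
and derivatives have no residue. For j = -1 only the leading term u⁻¹ counts. -/
theorem res_ddu_mul_fPow [Algebra ℂ R] (j : ℤ) :
    res (ddu (fSeries a) * fPow a j) = if j = -1 then 1 else 0 := by
  split_ifs with h
  · subst h
    have := (vanishesBelow_ddu_fSeries a).coeff_mul (vanishesBelow_fPow a (-1)).1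
    rwa [coeff_zero_ddu_fSeries, (vanishesBelow_fPow a (-1)).2, one_mul] at this
  · have h1 := res_ddu (fPow a (j + 1))
    rw [ddu_fPow, res_const_mul, add_sub_cancel_right, mul_comm (fPow a j)] at h1
    exact eq_zero_of_intCast_mul (by lia) h1

/-- The residue pairing with the powers of `f` detects the leading term. -/
theorem vanishesBelow_of_res {s : LaurentSeries R} {K : ℤ}
    (h : ∀ j < K, res (s * (ddu (fSeries a) * fPow a j)) = 0) : VanishesBelow (K + 1) s := by
  obtain ⟨N₀, h0⟩ := exists_vanishesBelow s
  have key (i : ℕ) (hi : N₀ + i ≤ K + 1) : VanishesBelow (N₀ + i) s := by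
    induction i with
    | zero => simpa using h0
    | succ i ih =>
      have h1 := ih (by push_cast at hi; lia)
      intro k hk
      rcases lt_or_ge k (N₀ + i) with hlt | hge
      · exact h1 k hlt
      · have hk' : k = N₀ + i := by push_cast at hk; lia
        -- The exponent k - 1 moves the leading term of the product exactly to u⁻¹.
        have h3 := vanishesBelow_fPow a (k - 1)
        have h4 := (vanishesBelow_ddu_fSeries a).mul h3.1
        have h5 := (vanishesBelow_ddu_fSeries a).coeff_mul h3.1
        rw [coeff_zero_ddu_fSeries, h3.2, one_mul] at h5
        have h2 := h1.coeff_mul h4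
        rw [h5, mul_one, show N₀ + (i : ℤ) + (0 + -(k - 1)) = 1 by lia] at h2
        rw [hk', ← h2]
        exact h (k - 1) (by push_cast at hi; lia)
  rcases le_or_gt (K + 1) N₀ with h' | h'
  · exact h0.mono h'
  · exact (key (K + 1 - N₀).toNat (by lia)).mono (by lia)

/-- Geometric series with exact remainder. The remainder has order at least K + 1 in u⁻¹, so a
residue sees only finitely many terms and no infinite sum is needed. -/
theorem fInv_eq_sum_add (b : R) (K : ℕ) :
    fInv a b = ∑ m ∈ Finset.range K, HahnSeries.C (b ^ m) * fInv a 0 ^ (m + 1)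
      + HahnSeries.C (b ^ K) * (fInv a 0 ^ K * fInv a b) := by
  have h : fInv a b = fInv a 0 + HahnSeries.C b * (fInv a 0 * fInv a b) := by
    linear_combination fInv a 0 * fSeries_sub_mul_fInv a b - fInv a b * fSeries_mul_fInv_zero a
  induction K with
  | zero => simp
  | succ K ih =>
    rw [Finset.sum_range_succ]
    conv_lhs => rw [ih]
    rw [pow_succ b, map_mul]
    linear_combination HahnSeries.C (b ^ K) * fInv a 0 ^ K * h

end Powers

/-! ### Change of coefficients -/

section Map

variable {R S : Type*} [CommRing R] [CommRing S] (φ : R →+* S)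

/-- The map of rings of Laurent series induced by a map of coefficient rings. -/
def mapHom : LaurentSeries R →+* LaurentSeries S where
  toFun s := s.map φ
  map_one' := by
    ext n
    rw [HahnSeries.map_coeff, HahnSeries.coeff_one, HahnSeries.coeff_one]
    split_ifs <;> simp
  map_mul' s t := HahnSeries.map_mul (φ : R →ₙ+* S)
  map_zero' := by ext; simp
  map_add' s t := by ext; simp

theorem coeff_mapHom (s : LaurentSeries R) (n : ℤ) : (mapHom φ s).coeff n = φ (s.coeff n) := rfl

theorem res_mapHom (s : LaurentSeries R) : res (mapHom φ s) = φ (res s) := rfl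

theorem mapHom_upow (k : ℤ) : mapHom φ (upow R k) = upow S k := by
  ext n
  rw [coeff_mapHom, upow, upow, HahnSeries.coeff_single, HahnSeries.coeff_single]
  split_ifs <;> simp

theorem mapHom_C (r : R) : mapHom φ (HahnSeries.C r) = HahnSeries.C (φ r) := by
  ext n
  rw [coeff_mapHom, HahnSeries.C_apply, HahnSeries.C_apply, HahnSeries.coeff_single,
    HahnSeries.coeff_single]
  split_ifs <;> simp

theorem mapHom_ddu (s : LaurentSeries R) : mapHom φ (ddu s) = ddu (mapHom φ s) := by
  ext n
  rw [coeff_mapHom, coeff_ddu, coeff_ddu, map_neg, map_zsmul, coeff_mapHom]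

theorem mapHom_fSeries (a : ℕ → R) : mapHom φ (fSeries a) = fSeries fun k => φ (a k) := by
  ext n
  rw [coeff_mapHom]
  rcases le_or_gt n (-1) with h | h
  · rw [coeff_fSeries_of_neg a h, coeff_fSeries_of_neg _ h]
    split_ifs <;> simp
  · rcases eq_or_ne n 0 with h0 | h0
    · subst h0
      rw [coeff_zero_fSeries, coeff_zero_fSeries, map_zero]
    · obtain ⟨k, rfl⟩ : ∃ k : ℕ, n = k + 1 := ⟨(n - 1).toNat, by lia⟩
      rw [coeff_fSeries_natCast_add_one, coeff_fSeries_natCast_add_one]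

theorem mapHom_fInv (a : ℕ → R) (b : R) :
    mapHom φ (fInv a b) = fInv (fun k => φ (a k)) (φ b) := by
  apply eq_fInv
  rw [← mapHom_fSeries, ← mapHom_C, ← map_sub, ← map_mul, fSeries_sub_mul_fInv, map_one]

end Map

/-! ### The polynomial vector fields -/

section Field

variable {R : Type*} [CommRing R] (a : ℕ → R) (n : ℤ)

/-- The value `p(f(u))` of a polynomial `p`. -/
def polyF (p : Polynomial R) : LaurentSeries R := p.eval₂ HahnSeries.C (fSeries a)

theorem polyF_add (p q : Polynomial R) : polyF a (p + q) = polyF a p + polyF a q :=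
  Polynomial.eval₂_add _ _
theorem polyF_sub (p q : Polynomial R) : polyF a (p - q) = polyF a p - polyF a q :=
  Polynomial.eval₂_sub _
theorem polyF_mul (p q : Polynomial R) : polyF a (p * q) = polyF a p * polyF a q :=
  Polynomial.eval₂_mul _ _
theorem polyF_C (r : R) : polyF a (Polynomial.C r) = HahnSeries.C r := Polynomial.eval₂_C _ _
theorem polyF_zero : polyF a 0 = 0 := Polynomial.eval₂_zero _ _
theorem polyF_X : polyF a Polynomial.X = fSeries a := Polynomial.eval₂_X _ _

/-- The coefficients `Res_u u^(1-n) f'(u)² f(u)^(-1-j)` of the vector field `f' u^(1-n)` in the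
coordinate `f`. -/
def vCoeff (j : ℤ) : R :=
  res (upow R (1 - n) * (ddu (fSeries a) ^ 2 * fPow a (-1 - j)))

/-- The polynomial part of the vector field `f' u^(1-n)` in the coordinate `f`. -/
def vPoly : Polynomial R :=
  -- The coefficients vanish from index 2 - n on (`vCoeff_eq_zero`), so this range loses nothing.
  ∑ m ∈ Finset.range (2 - n).toNat, Polynomial.monomial m (vCoeff a n m)

/-- The difference of the polynomial part and the vector field. -/
def vRem : LaurentSeries R := polyF a (vPoly a n) - upow R (1 - n) * ddu (fSeries a)

theorem vanishesBelow_vCoeff_arg {s : LaurentSeries R} {N : ℤ} (hs : VanishesBelow N s) :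
    VanishesBelow (n - 1 + N) (upow R (1 - n) * (ddu (fSeries a) ^ 2 * s)) := by
  have := (vanishesBelow_upow (R := R) (1 - n)).mul
    (((vanishesBelow_ddu_fSeries a).pow 2).mul hs)
  exact this.mono (by push_cast; lia)

theorem vCoeff_eq_zero {j : ℤ} (hj : 2 - n ≤ j) : vCoeff a n j = 0 :=
  (vanishesBelow_vCoeff_arg a n (vanishesBelow_fPow a (-1 - j)).1).res_eq_zero (by lia)

/-- Expanding 1/(f - b) in powers of b under the residue gives the coefficients of v_n. This
identifies v_n(p_i) with the coefficient of ∂/∂p_i in ℒ_n. -/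
theorem eval_vPoly (b : R) :
    (vPoly a n).eval b = res (upow R (1 - n) * (ddu (fSeries a) ^ 2 * fInv a b)) := by
  have h1 : VanishesBelow 2 (upow R (1 - n) * (ddu (fSeries a) ^ 2 *
      (HahnSeries.C (b ^ (2 - n).toNat) * (fInv a 0 ^ (2 - n).toNat * fInv a b)))) := by
    refine (vanishesBelow_vCoeff_arg a n ((VanishesBelow.const _).mul
      (((vanishesBelow_fInv a 0).pow (2 - n).toNat).mul (vanishesBelow_fInv a b)))).mono ?_
    lia
  conv_rhs => rw [fInv_eq_sum_add a b (2 - n).toNat]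
  rw [mul_add, mul_add, res_add, h1.res_eq_zero le_rfl, add_zero, Finset.mul_sum, Finset.mul_sum,
    res_sum, vPoly, Polynomial.eval_finsetSum]
  refine Finset.sum_congr rfl fun m _ => ?_
  have e : fPow a (-1 - m) = fInv a 0 ^ (m + 1) := by
    rw [← fPow_neg_natCast]; congr 1; push_cast; ring
  rw [Polynomial.eval_monomial, vCoeff, e, mul_comm, ← res_const_mul]
  congr 1
  ring

theorem polyF_eq_sum (p : Polynomial R) {K : ℕ} (hK : p.natDegree < K) :
    polyF a p = ∑ m ∈ Finset.range K, HahnSeries.C (p.coeff m) * fPow a m := by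
  rw [polyF, Polynomial.eval₂_eq_sum_range' _ hK]
  simp only [fPow_natCast]

/-- The powers f^m and the series f' f^(-1-m) are dual under the residue, so the pairing reads off
single coefficients of p. -/
theorem res_polyF [Algebra ℂ R] (p : Polynomial R) (j : ℤ) :
    res (polyF a p * (ddu (fSeries a) * fPow a j))
      = if j < 0 then p.coeff (-1 - j).toNat else 0 := by
  rw [polyF_eq_sum a p (Nat.lt_succ_self _), Finset.sum_mul, res_sum]
  have (m : ℕ) : res (HahnSeries.C (p.coeff m) * fPow a m * (ddu (fSeries a) * fPow a j))
      = if (m : ℤ) = -1 - j then p.coeff m else 0 := by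
    have e : HahnSeries.C (p.coeff m) * fPow a m * (ddu (fSeries a) * fPow a j)
        = HahnSeries.C (p.coeff m) * (ddu (fSeries a) * fPow a (m + j)) := by
      rw [fPow_add]; ring
    rw [e, res_const_mul, res_ddu_mul_fPow]
    by_cases h : (m : ℤ) = -1 - j
    · rw [if_pos (by lia), if_pos h, mul_one]
    · rw [if_neg (by lia), if_neg h, mul_zero]
  simp only [this]
  split_ifs with h
  · obtain ⟨i, hi⟩ : ∃ i : ℕ, (i : ℤ) = -1 - j := ⟨(-1 - j).toNat, by lia⟩
    rw [← hi, Int.toNat_natCast]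
    simp only [Nat.cast_inj]
    rw [Finset.sum_ite_eq']
    split_ifs with h'
    · rfl
    · rw [Polynomial.coeff_eq_zero_of_natDegree_lt]
      simpa using h'
  · exact Finset.sum_eq_zero fun m _ => if_neg (by lia)

theorem coeff_vPoly (m : ℕ) : (vPoly a n).coeff m = vCoeff a n m := by
  rw [vPoly, Polynomial.finsetSum_coeff]
  simp only [Polynomial.coeff_monomial]
  rw [Finset.sum_ite_eq']
  split_ifs with h
  · rfl
  · rw [vCoeff_eq_zero]
    simp only [Finset.mem_range] at h
    lia

/-- The series u^(1-n) f' is expanded in all powers of f. After removal of the polynomial part and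
of the first K negative powers, every pairing with f' f^j, j < K, vanishes. -/
theorem vanishesBelow_vRem_add [Algebra ℂ R] (K : ℕ) :
    VanishesBelow (K + 1) (vRem a n
      + ∑ m ∈ Finset.range K, HahnSeries.C (vCoeff a n (-1 - m)) * fPow a (-1 - m)) := by
  apply vanishesBelow_of_res a
  intro j hj
  rw [add_mul, vRem, sub_mul, res_add, res_sub, res_polyF, Finset.sum_mul, res_sum]
  have e1 : upow R (1 - n) * ddu (fSeries a) * (ddu (fSeries a) * fPow a j)
      = upow R (1 - n) * (ddu (fSeries a) ^ 2 * fPow a (-1 - (-1 - j))) := by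
    rw [show -1 - (-1 - j) = j by ring]; ring
  have e2 (m : ℕ) : res (HahnSeries.C (vCoeff a n (-1 - m)) * fPow a (-1 - m)
      * (ddu (fSeries a) * fPow a j)) = if (m : ℤ) = j then vCoeff a n (-1 - m) else 0 := by
    have e : HahnSeries.C (vCoeff a n (-1 - m)) * fPow a (-1 - m) * (ddu (fSeries a) * fPow a j)
        = HahnSeries.C (vCoeff a n (-1 - m)) * (ddu (fSeries a) * fPow a (-1 - m + j)) := by
      rw [fPow_add]; ring
    rw [e, res_const_mul, res_ddu_mul_fPow]
    by_cases h : (m : ℤ) = j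
    · rw [if_pos (by lia), if_pos h, mul_one]
    · rw [if_neg (by lia), if_neg h, mul_zero]
  rw [e1, ← vCoeff]
  simp only [e2]
  rcases lt_or_ge j 0 with h | h
  · rw [if_pos h, coeff_vPoly, Finset.sum_eq_zero fun m _ => if_neg (by lia)]
    rw [show (((-1 - j).toNat : ℕ) : ℤ) = -1 - j by lia, sub_self, add_zero]
  · obtain ⟨i, rfl⟩ : ∃ i : ℕ, j = i := ⟨j.toNat, by lia⟩
    rw [if_neg (by lia)]
    simp only [Nat.cast_inj]
    rw [Finset.sum_ite_eq', if_pos (by simpa using hj)]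
    ring

theorem vanishesBelow_vRem [Algebra ℂ R] : VanishesBelow 1 (vRem a n) := by
  simpa using vanishesBelow_vRem_add a n 0

/-- Since 1/(f(z) - f(u)) = ∑ f(u)^m f(z)^(-1-m) and f(z)^(-1-m) starts at z^(-1-m), the coefficient
of z^(-1-k) involves only m ≤ k. -/
theorem res_upow_mul_fInvTwo (k : ℕ) :
    res (upow _ (k : ℤ) * fInvTwo a) =
      ∑ m ∈ Finset.range (k + 1),
        fSeries a ^ m * HahnSeries.C ((fPow a (-1 - m)).coeff (k + 1)) := by
  have e (m : ℕ) : fInv (fun k => (HahnSeries.C (a k) : LaurentSeries R)) 0 ^ (m + 1)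
      = mapHom HahnSeries.C (fPow a (-1 - m)) := by
    have e : fPow a (-1 - m) = fInv a 0 ^ (m + 1) := by
      rw [← fPow_neg_natCast]; congr 1; push_cast; ring
    rw [e, map_pow, mapHom_fInv, map_zero]
  rw [res_upow_mul, fInvTwo, fInv_eq_sum_add _ _ (k + 1), HahnSeries.coeff_add]
  have h : VanishesBelow (k + 2) (HahnSeries.C (fSeries a ^ (k + 1)) *
      (fInv (fun k => (HahnSeries.C (a k) : LaurentSeries R)) 0 ^ (k + 1) *
        fInv (fun k => (HahnSeries.C (a k) : LaurentSeries R)) (fSeries a))) := by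
    refine ((VanishesBelow.const _).mul
      (((vanishesBelow_fInv _ 0).pow (k + 1)).mul (vanishesBelow_fInv _ _))).mono ?_
    push_cast; lia
  rw [h _ (by lia), add_zero, HahnSeries.coeff_sum]
  refine Finset.sum_congr rfl fun m _ => ?_
  rw [e, HahnSeries.C_apply, HahnSeries.coeff_single_zero_mul]
  rfl

/-- The coefficients of `∂/∂f_l` in the operator `ℒ_n` are those of the series `vRem`. -/
theorem coeff_vRem [Algebra ℂ R] (k : ℕ) :
    (vRem a n).coeff (k + 1) = -res (upow R (1 - n) *
      (ddu (fSeries a) ^ 2 * res (upow _ (k : ℤ) * fInvTwo a))) := by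
  have h := vanishesBelow_vRem_add a n (k + 1) (k + 1) (by push_cast; lia)
  rw [HahnSeries.coeff_add] at h
  rw [eq_neg_of_add_eq_zero_left h, res_upow_mul_fInvTwo, HahnSeries.coeff_sum, Finset.mul_sum,
    Finset.mul_sum, res_sum]
  congr 1
  refine Finset.sum_congr rfl fun m _ => ?_
  rw [HahnSeries.C_apply, HahnSeries.coeff_single_zero_mul, vCoeff, ← fPow_natCast, mul_comm,
    ← res_const_mul, show -1 - (-1 - (m : ℤ)) = m by ring]
  congr 1
  ring

/-- The uniqueness principle behind all the bracket computations. Pairing with f' f^(-1-m) extracts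
the m-th coefficient, while the product has order at least 2 in u⁻¹ and hence no residue. -/
theorem eq_zero_of_vanishesBelow_polyF [Algebra ℂ R] {p : Polynomial R}
    (h : VanishesBelow 1 (polyF a p)) : p = 0 := by
  ext m
  have h1 := res_polyF a p (-1 - m)
  rw [if_pos (by lia), show (-1 - (-1 - (m : ℤ))).toNat = m by lia] at h1
  rw [← h1, Polynomial.coeff_zero]
  refine (h.mul ((vanishesBelow_ddu_fSeries a).mul (vanishesBelow_fPow a _).1)).res_eq_zero ?_
  lia

end Field

open Polynomial in
/-- The action of a derivation on the coefficients of a polynomial. -/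
def polyD {R : Type*} [CommRing R] [Algebra ℂ R] (E : Derivation ℂ R R) (p : R[X]) : R[X] :=
  p.sum fun i r => monomial i (E r)

/-! ### Chain rules for derivations acting on coefficients of polynomials -/

section PolyD

open Polynomial

variable {R : Type*} [CommRing R] [Algebra ℂ R] (E : Derivation ℂ R R)

theorem polyD_monomial (i : ℕ) (r : R) : polyD E (monomial i r) = monomial i (E r) :=
  sum_monomial_index r (fun i r => monomial i (E r)) (by simp)

theorem polyD_add (p q : R[X]) : polyD E (p + q) = polyD E p + polyD E q :=
  sum_add_index p q _ (by simp) (by simp)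

theorem derivative_polyD (p : R[X]) : derivative (polyD E p) = polyD E (derivative p) := by
  induction p using Polynomial.induction_on' with
  | add p q hp hq => simp only [polyD_add, derivative_add, hp, hq]
  | monomial i r => simp [polyD_monomial, derivative_monomial, mul_comm]

theorem apply_eval (p : R[X]) (b : R) :
    E (p.eval b) = (polyD E p).eval b + (derivative p).eval b * E b := by
  induction p using Polynomial.induction_on' with
  | add p q hp hq => simp only [polyD_add, eval_add, map_add, hp, hq]; ring
  | monomial i r => simp [polyD_monomial, derivative_monomial]; ring

omit [Algebra ℂ R] in
theorem ddu_polyF (a : ℕ → R) (p : R[X]) :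
    ddu (polyF a p) = polyF a (derivative p) * ddu (fSeries a) := by
  induction p using Polynomial.induction_on' with
  | add p q hp hq => simp only [derivative_add, polyF_add, ddu_add, hp, hq]; ring
  | monomial i r =>
    have h := ddu_fPow a i
    rw [fPow_natCast] at h
    rw [derivative_monomial, polyF, polyF, eval₂_monomial, eval₂_monomial, ddu_mul, ddu_C, h]
    rcases i with _ | i
    · simp
    · rw [show ((i + 1 : ℕ) : ℤ) - 1 = (i : ℤ) by push_cast; ring, fPow_natCast]
      push_cast
      simp only [map_mul, map_add, map_one, mul_zero, add_zero]
      ring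

theorem onCoeff_pow (s : LaurentSeries R) (k : ℕ) :
    onCoeff E (s ^ k) = k * s ^ (k - 1) * onCoeff E s := by
  induction k with
  | zero => simp [onCoeff_one]
  | succ k ih =>
    rw [pow_succ, onCoeff_mul, ih, Nat.add_sub_cancel]
    rcases k with _ | k
    · simp
    · rw [Nat.add_sub_cancel]; push_cast; ring

theorem onCoeff_polyF (a : ℕ → R) (p : R[X]) :
    onCoeff E (polyF a p)
      = polyF a (polyD E p) + polyF a (derivative p) * onCoeff E (fSeries a) := by
  induction p using Polynomial.induction_on' with
  | add p q hp hq => simp only [polyD_add, derivative_add, polyF_add, onCoeff_add, hp, hq]; ring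
  | monomial i r =>
    rw [polyD_monomial, derivative_monomial, polyF, polyF, polyF, eval₂_monomial, eval₂_monomial,
      eval₂_monomial, onCoeff_mul, onCoeff_C, onCoeff_pow, map_mul, map_natCast]
    ring

end PolyD

/-! ### The Schwarzian derivative -/

section Schwarzian

variable {R : Type*} [CommRing R] [Algebra ℂ R] (a : ℕ → R)

/-- The operator `τ ↦ τ''' + 2 Sf τ' + (Sf)' τ`. -/
def bol (τ : LaurentSeries R) : LaurentSeries R :=
  ddu (ddu (ddu τ)) + 2 * schwarzian (fSeries a) * ddu τ + ddu (schwarzian (fSeries a)) * τ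

theorem bol_sub (σ τ : LaurentSeries R) : bol a (σ - τ) = bol a σ - bol a τ := by
  simp only [bol, ddu_sub]; ring

/-- The complex scalar 3/2 is traded for a ring element c with 2c = 1, so that identities for Sf
become polynomial identities modulo this relation. -/
theorem exists_half : ∃ c : R, 2 * c = 1 ∧ ∀ s : LaurentSeries R,
    schwarzian s = ddu (ddu (ddu s)) * Ring.inverse (ddu s)
      - 3 * HahnSeries.C c * (ddu (ddu s) * Ring.inverse (ddu s)) ^ 2 := by
  refine ⟨algebraMap ℂ R (1 / 2), ?_, fun s => ?_⟩
  · rw [← map_ofNat (algebraMap ℂ R) 2, ← map_mul]; norm_num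
  · rw [schwarzian]
    congr 1
    ext n
    rw [HahnSeries.coeff_smul, mul_assoc, ← map_ofNat HahnSeries.C 3, ← mul_assoc, ← map_mul,
      HahnSeries.C_apply, HahnSeries.coeff_single_zero_mul, Algebra.smul_def,
      ← map_ofNat (algebraMap ℂ R) 3, ← map_mul]
    norm_num

omit [Algebra ℂ R] in
theorem ddu_dduInv : ddu (dduInv a) = -(dduInv a ^ 2 * ddu (ddu (fSeries a))) := by
  have h0 := ddu_mul_dduInv a
  have h := congrArg ddu h0
  rw [ddu_one, ddu_mul] at h
  linear_combination dduInv a * h - ddu (dduInv a) * h0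

theorem onCoeff_dduInv (E : Derivation ℂ R R) :
    onCoeff E (dduInv a) = -(dduInv a ^ 2 * onCoeff E (ddu (fSeries a))) := by
  have h0 := ddu_mul_dduInv a
  have h := congrArg (onCoeff E) h0
  rw [onCoeff_one, onCoeff_mul] at h
  linear_combination dduInv a * h - onCoeff E (dduInv a) * h0

/-- The operator `bol` contains only 2Sf and (Sf)', and both have integer coefficients in the
derivatives of f and 1/f', so the factor 1/2 drops out. -/
theorem ddu_schwarzian_and {c : R} (hc : 2 * c = 1) (hS : schwarzian (fSeries a)
      = ddu (ddu (ddu (fSeries a))) * dduInv a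
        - 3 * HahnSeries.C c * (ddu (ddu (fSeries a)) * dduInv a) ^ 2) :
    2 * schwarzian (fSeries a) = 2 * ddu (ddu (ddu (fSeries a))) * dduInv a
        - 3 * (ddu (ddu (fSeries a)) * dduInv a) ^ 2 ∧
    ddu (schwarzian (fSeries a)) = ddu (ddu (ddu (ddu (fSeries a)))) * dduInv a
      - 4 * ddu (ddu (ddu (fSeries a))) * ddu (ddu (fSeries a)) * dduInv a ^ 2
      + 3 * ddu (ddu (fSeries a)) ^ 3 * dduInv a ^ 3 := by
  have hC : 2 * (HahnSeries.C c : LaurentSeries R) = 1 := by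
    rw [← map_ofNat HahnSeries.C 2, ← map_mul, hc, map_one]
  constructor
  · rw [hS]
    linear_combination (-3 * (ddu (ddu (fSeries a)) * dduInv a) ^ 2) * hC
  · rw [hS, ddu_sub, pow_two]
    simp only [ddu_mul, ddu_C, ddu_dduInv, ddu_three, mul_assoc]
    linear_combination (-3 * ddu (ddu (fSeries a)) * dduInv a * (ddu (ddu (ddu (fSeries a)))
      * dduInv a - ddu (ddu (fSeries a)) ^ 2 * dduInv a ^ 2)) * hC

theorem schwarzian_eqs :
    2 * schwarzian (fSeries a) = 2 * ddu (ddu (ddu (fSeries a))) * dduInv a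
        - 3 * (ddu (ddu (fSeries a)) * dduInv a) ^ 2 ∧
    ddu (schwarzian (fSeries a)) = ddu (ddu (ddu (ddu (fSeries a)))) * dduInv a
      - 4 * ddu (ddu (ddu (fSeries a))) * ddu (ddu (fSeries a)) * dduInv a ^ 2
      + 3 * ddu (ddu (fSeries a)) ^ 3 * dduInv a ^ 3 := by
  obtain ⟨c, hc, hS⟩ := exists_half (R := R)
  exact ddu_schwarzian_and a hc (hS _)

/-- The variation of the Schwarzian derivative. -/
theorem onCoeff_schwarzian (E : Derivation ℂ R R) :
    onCoeff E (schwarzian (fSeries a)) = bol a (onCoeff E (fSeries a) * dduInv a) := by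
  obtain ⟨c, hc, hS⟩ := exists_half (R := R)
  have hS := hS (fSeries a)
  rw [← dduInv] at hS
  have hC : 2 * (HahnSeries.C c : LaurentSeries R) = 1 := by
    rw [← map_ofNat HahnSeries.C 2, ← map_mul, hc, map_one]
  have hCE : onCoeff E (HahnSeries.C c) = 0 := by
    have := congrArg (onCoeff E) hC
    rw [onCoeff_one, onCoeff_mul, onCoeff_two] at this
    linear_combination HahnSeries.C c * this - onCoeff E (HahnSeries.C c) * hC
  obtain ⟨hS2, hS'⟩ := schwarzian_eqs a
  have h0 := ddu_mul_dduInv a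
  rw [bol, hS2, hS', hS]
  generalize hτ : onCoeff E (fSeries a) * dduInv a = τ
  have hφ : onCoeff E (fSeries a) = τ * ddu (fSeries a) := by
    rw [← hτ]; linear_combination (-onCoeff E (fSeries a)) * h0
  simp only [pow_two, onCoeff_sub, onCoeff_mul, hCE, onCoeff_three, onCoeff_dduInv, onCoeff_ddu,
    hφ, ddu_mul, ddu_add, mul_assoc]
  -- With δf = τ f' substituted, the claim is a polynomial identity in the derivatives of f and τ,
  -- modulo f' · (1/f') = 1 and 2c = 1.
  generalize ddu (ddu (ddu (ddu (fSeries a)))) = w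
  generalize ddu (ddu (ddu (fSeries a))) = r
  generalize ddu (ddu (fSeries a)) = q
  generalize ddu (fSeries a) = p at h0
  generalize dduInv a = g at h0
  generalize ddu (ddu (ddu τ)) = τ3
  generalize ddu (ddu τ) = τ2
  generalize ddu τ = τ1
  generalize (HahnSeries.C c : LaurentSeries R) = c at hC
  linear_combination (τ3 - r * g * τ1 - 6 * c * q * g * (τ2 - q * g * τ1)) * h0
    - 3 * q * g * (τ2 + τ1 * q * g + τ * r * g - q ^ 2 * g ^ 2 * τ) * hC

/-- The series φ₁, φ₂, φ₃ are the successive derivatives of φ₀ with respect to f, and φ₀/f' is the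
vector field φ₀ ∂_f in the coordinate u. In the coordinate f the Schwarzian term disappears and only
the third derivative is left. Describing the φ_j by relations covers both polynomials in f and 1/(f
- x). -/
theorem bol_comp {φ₀ φ₁ φ₂ φ₃ : LaurentSeries R} (h₀ : ddu φ₀ = φ₁ * ddu (fSeries a))
    (h₁ : ddu φ₁ = φ₂ * ddu (fSeries a)) (h₂ : ddu φ₂ = φ₃ * ddu (fSeries a)) :
    bol a (φ₀ * dduInv a) = φ₃ * ddu (fSeries a) ^ 2 := by
  obtain ⟨hS2, hS'⟩ := schwarzian_eqs a
  have hp := ddu_mul_dduInv a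
  have hg := ddu_dduInv a
  rw [bol, hS2, hS']
  have d1 : ddu (φ₀ * dduInv a) = φ₁ - φ₀ * (dduInv a * dduInv a * ddu (ddu (fSeries a))) := by
    rw [ddu_mul, h₀, hg]
    linear_combination φ₁ * hp
  have d2 : ddu (ddu (φ₀ * dduInv a)) = φ₂ * ddu (fSeries a)
      - φ₁ * (dduInv a * ddu (ddu (fSeries a)))
      + 2 * (φ₀ * (dduInv a * (dduInv a * dduInv a) *
          (ddu (ddu (fSeries a)) * ddu (ddu (fSeries a)))))
      - φ₀ * (dduInv a * dduInv a * ddu (ddu (ddu (fSeries a)))) := by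
    rw [d1]
    simp only [ddu_sub, ddu_mul, hg, h₀, h₁]
    linear_combination (-φ₁ * dduInv a * ddu (ddu (fSeries a))) * hp
  rw [d2, d1]
  simp only [ddu_sub, ddu_add, ddu_two, ddu_mul, hg, h₀, h₁, h₂]
  linear_combination (-φ₂ * ddu (ddu (fSeries a))
    + 2 * φ₁ * dduInv a ^ 2 * ddu (ddu (fSeries a)) ^ 2
    - φ₁ * dduInv a * ddu (ddu (ddu (fSeries a)))) * hp

/-- The symmetrised expression σ·bol(τ) + τ·bol(σ) is a total derivative. -/
theorem res_mul_bol (σ τ : LaurentSeries R) : res (σ * bol a τ) = -res (τ * bol a σ) := by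
  have h : σ * bol a τ + τ * bol a σ = ddu (σ * ddu (ddu τ) - ddu σ * ddu τ + ddu (ddu σ) * τ
      + 2 * (schwarzian (fSeries a) * (σ * τ))) := by
    simp only [bol, ddu_sub, ddu_add, ddu_two, ddu_mul]
    ring
  have h2 := congrArg res h
  rw [res_ddu, res_add] at h2
  exact eq_neg_of_add_eq_zero_left h2

theorem vanishesBelow_schwarzian : VanishesBelow 0 (schwarzian (fSeries a)) := by
  obtain ⟨c, hc, hS⟩ := exists_half (R := R)
  rw [hS, ← dduInv]
  have h1 := (vanishesBelow_ddu_fSeries a).ddu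
  have h3 : VanishesBelow 0 (3 * HahnSeries.C c : LaurentSeries R) := by
    rw [← map_ofNat HahnSeries.C 3, ← map_mul]
    exact VanishesBelow.const _
  refine ((h1.ddu.mul (vanishesBelow_dduInv a)).mono (by lia)).sub
    ((h3.mul ((h1.mul (vanishesBelow_dduInv a)).pow 2)).mono (by lia))

theorem VanishesBelow.bol {τ : LaurentSeries R} {N : ℤ} (h : VanishesBelow N τ) :
    VanishesBelow N (bol a τ) := by
  have hS := vanishesBelow_schwarzian a
  have h2 : VanishesBelow 0 (2 * schwarzian (fSeries a)) := by
    rw [← map_ofNat HahnSeries.C 2]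
    exact hS.const_mul _
  exact ((h.ddu.ddu.ddu.mono (by lia)).add ((h2.mul h.ddu).mono (by lia))).add
    ((hS.ddu.mul h).mono (by lia))

end Schwarzian

/-! ### The vector fields of the Virasoro algebra -/

section VectorFields

open Polynomial

variable {R : Type*} [CommRing R] [Algebra ℂ R] {a : ℕ → R}

theorem onCoeff_fSeries_eq {E : Derivation ℂ R R} {s : LaurentSeries R} (hs : VanishesBelow 1 s)
    (h : ∀ k : ℕ, E (a k) = s.coeff (k + 1)) : onCoeff E (fSeries a) = s := by
  ext n
  rcases le_or_gt n 0 with hn | hn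
  · rw [hs n (by lia), coeff_onCoeff]
    rcases hn.lt_or_eq with hn | rfl
    · rw [coeff_fSeries_of_neg a (by lia)]
      split_ifs <;> simp
    · rw [coeff_zero_fSeries, map_zero]
  · obtain ⟨k, rfl⟩ : ∃ k : ℕ, n = k + 1 := ⟨(n - 1).toNat, by lia⟩
    rw [onCoeff_fSeries, h]

theorem onCoeff_vRem (E : Derivation ℂ R R) (n : ℤ) :
    onCoeff E (vRem a n) = polyF a (polyD E (vPoly a n))
      + polyF a (derivative (vPoly a n)) * onCoeff E (fSeries a)
      - upow R (1 - n) * ddu (onCoeff E (fSeries a)) := by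
  rw [vRem, onCoeff_sub, onCoeff_polyF, onCoeff_mul, onCoeff_upow, onCoeff_ddu]
  ring

omit [Algebra ℂ R] in
theorem vRem_mul_dduInv (n : ℤ) :
    vRem a n * dduInv a = polyF a (vPoly a n) * dduInv a - upow R (1 - n) := by
  rw [vRem]
  linear_combination (-upow R (1 - n)) * ddu_mul_dduInv a

/-! ### Brackets of two Virasoro vector fields -/

section Bracket

variable {D D' : Derivation ℂ R R} {n m : ℤ} (hD : onCoeff D (fSeries a) = vRem a n)
  (hD' : onCoeff D' (fSeries a) = vRem a m)

include hD hD'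

/-- Products of a polynomial in f with a power of u cancel by antisymmetry. What survives is the
action on v_n and v_m, their bracket in the coordinate f, and the bracket of u^(1-n) with u^(1-m).
-/
theorem onCoeff_vRem_sub :
    onCoeff D (vRem a m) - onCoeff D' (vRem a n) =
      polyF a (polyD D (vPoly a m) - polyD D' (vPoly a n)
        + (vPoly a n * derivative (vPoly a m) - vPoly a m * derivative (vPoly a n)))
      - HahnSeries.C ((n : R) - m) * (upow R (1 - (n + m)) * ddu (fSeries a)) := by
  have e1 : upow R (1 - m) * upow R (1 - n - 1) = upow R (1 - (n + m)) := by
    rw [← upow_add]; congr 1; ring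
  have e2 : upow R (1 - n) * upow R (1 - m - 1) = upow R (1 - (n + m)) := by
    rw [← upow_add]; congr 1; ring
  rw [onCoeff_vRem, onCoeff_vRem, hD, hD', vRem, vRem, polyF_add, polyF_sub, polyF_sub, polyF_mul,
    polyF_mul, ddu_sub, ddu_sub, ddu_mul, ddu_mul, ddu_polyF, ddu_polyF, ddu_upow, ddu_upow]
  push_cast
  simp only [map_sub, map_one]
  linear_combination
    (ddu (fSeries a)) * (1 - HahnSeries.C (n : R)) * e1
    - (ddu (fSeries a)) * (1 - HahnSeries.C (m : R)) * e2

/-- By `onCoeff_vRem_sub`, the difference of the two sides evaluated at f is a combination of three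
series of size O(u⁻¹), so the uniqueness principle applies. -/
theorem polyD_vPoly_sub :
    polyD D (vPoly a m) - polyD D' (vPoly a n)
      + (vPoly a n * derivative (vPoly a m) - vPoly a m * derivative (vPoly a n))
      = C ((n : R) - m) * vPoly a (n + m) := by
  rw [← sub_eq_zero]
  apply eq_zero_of_vanishesBelow_polyF a
  rw [polyF_sub, polyF_mul, polyF_C]
  have h := onCoeff_vRem_sub hD hD'
  have h1 : VanishesBelow 1 (onCoeff D (vRem a m) - onCoeff D' (vRem a n)
      - HahnSeries.C ((n : R) - m) * vRem a (n + m)) :=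
    (((vanishesBelow_vRem a m).onCoeff D).sub ((vanishesBelow_vRem a n).onCoeff D')).sub
      ((vanishesBelow_vRem a _).const_mul _)
  rw [h, vRem] at h1
  convert h1 using 1
  ring

theorem onCoeff_vRem_sub_eq :
    onCoeff D (vRem a m) - onCoeff D' (vRem a n) = HahnSeries.C ((n : R) - m) * vRem a (n + m) := by
  rw [onCoeff_vRem_sub hD hD', polyD_vPoly_sub hD hD', polyF_mul, polyF_C, vRem]
  ring

theorem apply_eval_vPoly_sub {x : R} (hx : D x = (vPoly a n).eval x)
    (hx' : D' x = (vPoly a m).eval x) :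
    D ((vPoly a m).eval x) - D' ((vPoly a n).eval x) = (n - m) * (vPoly a (n + m)).eval x := by
  have h := congrArg (eval x) (polyD_vPoly_sub hD hD')
  simp only [eval_add, eval_sub, eval_mul, eval_C] at h
  rw [apply_eval, apply_eval, hx, hx']
  linear_combination h

theorem apply_eval_derivative_vPoly_sub {x : R} (hx : D x = (vPoly a n).eval x)
    (hx' : D' x = (vPoly a m).eval x) :
    D ((derivative (vPoly a m)).eval x) - D' ((derivative (vPoly a n)).eval x)
      = (n - m) * (derivative (vPoly a (n + m))).eval x := by
  have h := congrArg (fun p => eval x (derivative p)) (polyD_vPoly_sub hD hD')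
  simp only [derivative_add, derivative_sub, derivative_mul, derivative_polyD, derivative_C,
    eval_add, eval_sub, eval_mul, eval_C, eval_zero] at h
  rw [apply_eval, apply_eval, hx, hx']
  linear_combination h

/-- The Schwarzian cocycle. -/
theorem apply_res_schwarzian_sub :
    D (res (upow R (1 - m) * schwarzian (fSeries a)))
      - D' (res (upow R (1 - n) * schwarzian (fSeries a)))
      = (n - m) * res (upow R (1 - (n + m)) * schwarzian (fSeries a))
        + if n + m = 0 then (n : R) ^ 3 - n else 0 := by
  have hE (E : Derivation ℂ R R) (k l : ℤ) (hE : onCoeff E (fSeries a) = vRem a k) :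
      E (res (upow R (1 - l) * schwarzian (fSeries a)))
        = res (upow R (1 - l) * bol a (polyF a (vPoly a k) * dduInv a))
          - res (upow R (1 - l) * bol a (upow R (1 - k))) := by
    rw [← res_onCoeff, onCoeff_mul, onCoeff_upow, onCoeff_schwarzian, hE, vRem_mul_dduInv, bol_sub,
      mul_zero, add_zero, mul_sub, res_sub]
  -- In the coordinate f the pairing of the two polynomial parts is a polynomial in f times f',
  -- which has no residue.
  have hpp : res (polyF a (vPoly a m) * dduInv a * bol a (polyF a (vPoly a n) * dduInv a)) = 0 := by
    rw [bol_comp a (ddu_polyF a _) (ddu_polyF a _) (ddu_polyF a _)]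
    have := res_polyF a (vPoly a m * derivative (derivative (derivative (vPoly a n)))) 0
    rw [if_neg (lt_irrefl _), polyF_mul, fPow_zero] at this
    rw [← this]
    congr 1
    linear_combination (polyF a (vPoly a m) *
      polyF a (derivative (derivative (derivative (vPoly a n)))) * ddu (fSeries a))
        * ddu_mul_dduInv a
  -- Both factors are O(u⁻¹), so the full pairing is zero. Expanded into four terms, it links the
  -- two mixed pairings, which are the actions of D and D', to the pairing of the two monomials.
  have hττ : res ((polyF a (vPoly a m) * dduInv a - upow R (1 - m)) *
      bol a (polyF a (vPoly a n) * dduInv a - upow R (1 - n))) = 0 := by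
    rw [← vRem_mul_dduInv, ← vRem_mul_dduInv]
    have h1 (k : ℤ) : VanishesBelow 1 (vRem a k * dduInv a) := by
      simpa using (vanishesBelow_vRem a k).mul (vanishesBelow_dduInv a)
    exact ((h1 m).mul ((h1 n).bol a)).res_eq_zero (by lia)
  rw [bol_sub, mul_sub, sub_mul, sub_mul, res_sub, res_sub, res_sub, hpp] at hττ
  rw [hE D n m hD, hE D' m n hD', res_mul_bol a (upow R (1 - n)) (polyF a (vPoly a m) * dduInv a),
    res_mul_bol a (upow R (1 - n)) (upow R (1 - m))]
  have e1 : upow R (1 - m) * upow R (1 - n - 1) = upow R (1 - (n + m)) := by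
    rw [← upow_add]; congr 1; ring
  have e2 : upow R (1 - n) * upow R (1 - m - 1) = upow R (1 - (n + m)) := by
    rw [← upow_add]; congr 1; ring
  have e3 : upow R (1 - m) * upow R (1 - n - 1 - 1 - 1) = upow R (-1 - (n + m)) := by
    rw [← upow_add]; congr 1; ring
  have e4 : res (upow R (-1 - (n + m))) = if n + m = 0 then 1 else 0 := by
    rw [res, upow, HahnSeries.coeff_single]
    by_cases h : n + m = 0
    · rw [if_pos h, if_pos (by lia)]
    · rw [if_neg h, if_neg (by lia)]
  -- The terms in Sf combine to -(n-m) Sf u^(1-(n+m)) up to a total derivative. The third derivative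
  -- of u^(1-n) contributes the cubic factor -(n³-n), the source of the central term.
  have hK : res (upow R (1 - m) * bol a (upow R (1 - n)))
      = -((n : R) - m) * res (upow R (1 - (n + m)) * schwarzian (fSeries a))
        - ((n : R) ^ 3 - n) * res (upow R (-1 - (n + m))) := by
    have h : upow R (1 - m) * bol a (upow R (1 - n))
        = HahnSeries.C (-((n : R) - m)) * (upow R (1 - (n + m)) * schwarzian (fSeries a))
          - HahnSeries.C ((n : R) ^ 3 - n) * upow R (-1 - (n + m))
          + ddu (schwarzian (fSeries a) * (upow R (1 - n) * upow R (1 - m))) := by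
      simp only [bol, ddu_mul, ddu_upow, ddu_C]
      push_cast
      simp only [map_sub, map_one, map_pow, map_neg, ddu_add, ddu_sub, ddu_mul, ddu_upow, ddu_C,
        ddu_one, ddu_zero]
      push_cast
      simp only [map_sub, map_one]
      linear_combination
        (HahnSeries.C (n : R) - HahnSeries.C (n : R) ^ 3) * e3
        + schwarzian (fSeries a) * (1 - HahnSeries.C (n : R)) * e1
        - schwarzian (fSeries a) * (1 - HahnSeries.C (m : R)) * e2
    rw [h, res_add, res_sub, res_const_mul, res_const_mul, res_ddu, add_zero]
  have e5 : (if n + m = 0 then (n : R) ^ 3 - n else 0)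
      = ((n : R) ^ 3 - n) * res (upow R (-1 - (n + m))) := by
    rw [e4]; split_ifs <;> simp
  rw [e5]
  linear_combination -hττ - hK

end Bracket

end VectorFields

/-! ### The Loewner vector field -/

section Loewner

open Polynomial

variable {R : Type*} [CommRing R] [Algebra ℂ R] {a : ℕ → R}

omit [Algebra ℂ R] in
theorem ddu_fInv (a : ℕ → R) (x : R) : ddu (fInv a x) = -(fInv a x ^ 2 * ddu (fSeries a)) := by
  have h0 := fSeries_sub_mul_fInv a x
  have h := congrArg ddu h0
  rw [ddu_one, ddu_mul, ddu_sub, ddu_C] at h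
  linear_combination fInv a x * h - ddu (fInv a x) * h0

theorem onCoeff_fInv (E : Derivation ℂ R R) (a : ℕ → R) (x : R) :
    onCoeff E (fInv a x)
      = -(fInv a x ^ 2 * (onCoeff E (fSeries a) - HahnSeries.C (E x))) := by
  have h0 := fSeries_sub_mul_fInv a x
  have h := congrArg (onCoeff E) h0
  rw [onCoeff_one, onCoeff_mul, onCoeff_sub, onCoeff_C] at h
  linear_combination fInv a x * h - onCoeff E (fInv a x) * h0

/-! ### The derivation ∂/∂x, which fixes f -/

section Partial

variable {P : Derivation ℂ R R} (hP : ∀ k, P (a k) = 0) {x : R} (hx : P x = 1) (n : ℤ)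

include hP

theorem onCoeff_fSeries_of_eq_zero : onCoeff P (fSeries a) = 0 :=
  onCoeff_fSeries_eq VanishesBelow.zero hP

/-- Since P kills f, applying it to v_n(f) - u^(1-n) f' leaves only the polynomial with
differentiated coefficients, and this is still O(u⁻¹). -/
theorem polyD_vPoly_of_eq_zero : polyD P (vPoly a n) = 0 := by
  apply eq_zero_of_vanishesBelow_polyF a
  have h := onCoeff_vRem (a := a) P n
  rw [onCoeff_fSeries_of_eq_zero hP, ddu_zero, mul_zero, mul_zero, add_zero, sub_zero] at h
  rw [← h]
  exact (vanishesBelow_vRem a n).onCoeff P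

theorem apply_eval_vPoly_of_eq_zero (y : R) :
    P ((vPoly a n).eval y) = (derivative (vPoly a n)).eval y * P y := by
  rw [apply_eval, polyD_vPoly_of_eq_zero hP, eval_zero, zero_add]

theorem apply_eval_derivative_vPoly_of_eq_zero (y : R) :
    P ((derivative (vPoly a n)).eval y)
      = (derivative (derivative (vPoly a n))).eval y * P y := by
  rw [apply_eval, ← derivative_polyD, polyD_vPoly_of_eq_zero hP, derivative_zero, eval_zero,
    zero_add]

theorem apply_eval_derivative_derivative_vPoly_of_eq_zero (y : R) :
    P ((derivative (derivative (vPoly a n))).eval y)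
      = (derivative (derivative (derivative (vPoly a n)))).eval y * P y := by
  rw [apply_eval, ← derivative_polyD, ← derivative_polyD, polyD_vPoly_of_eq_zero hP,
    derivative_zero, derivative_zero, eval_zero, zero_add]

include hx

theorem apply_res_fInv_pow (k : ℕ) :
    P (res (upow R (1 - n) * (ddu (fSeries a) ^ 2 * fInv a x ^ k)))
      = k * res (upow R (1 - n) * (ddu (fSeries a) ^ 2 * fInv a x ^ (k + 1))) := by
  have h1 : onCoeff P (fInv a x) = fInv a x ^ 2 := by
    rw [onCoeff_fInv, onCoeff_fSeries_of_eq_zero hP, hx, map_one]; ring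
  have h2 : onCoeff P (ddu (fSeries a)) = 0 := by
    rw [onCoeff_ddu, onCoeff_fSeries_of_eq_zero hP, ddu_zero]
  rw [← res_onCoeff, ← res_const_mul, onCoeff_mul, onCoeff_mul, onCoeff_pow, onCoeff_pow, h1, h2,
    onCoeff_upow, map_natCast]
  congr 1
  rcases k with _ | k
  · simp
  · rw [Nat.add_sub_cancel]; push_cast; ring

/-- On values v_n(x) the derivation P is the formal derivative, and under the residue it
differentiates 1/(f - x). Equating the two shows that v_n'(x) is the coefficient of the conformal
weight in ℒ_n. -/
theorem eval_derivative_vPoly :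
    (derivative (vPoly a n)).eval x
      = res (upow R (1 - n) * (ddu (fSeries a) ^ 2 * fInv a x ^ 2)) := by
  have h := apply_eval_vPoly_of_eq_zero hP n x
  have h1 := apply_res_fInv_pow hP hx n 1
  rw [hx, mul_one, eval_vPoly] at h
  rw [pow_one, Nat.cast_one, one_mul] at h1
  rw [← h, h1]

theorem eval_derivative_derivative_derivative_vPoly :
    (derivative (derivative (derivative (vPoly a n)))).eval x
      = 6 * res (upow R (1 - n) * (ddu (fSeries a) ^ 2 * fInv a x ^ 4)) := by
  have h2 := apply_eval_derivative_vPoly_of_eq_zero hP n x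
  have h3 := apply_eval_derivative_derivative_vPoly_of_eq_zero hP n x
  rw [hx, mul_one] at h2 h3
  rw [← h3, ← h2, eval_derivative_vPoly hP hx, apply_res_fInv_pow hP hx, Derivation.leibniz,
    apply_res_fInv_pow hP hx, Derivation.map_natCast, smul_zero, add_zero, smul_eq_mul]
  push_cast
  ring

end Partial

-- Iterated division by X - x. The coefficients stay undivided by factorials; order four is enough,
-- as values and first derivatives at x are needed only after division by (X - x)².
omit [Algebra ℂ R] in
theorem exists_taylor (p : R[X]) (x : R) : ∃ (v₂ v₃ : R) (r : R[X]),
    p = C (p.eval x) + C ((derivative p).eval x) * (X - C x) + C v₂ * (X - C x) ^ 2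
      + C v₃ * (X - C x) ^ 3 + r * (X - C x) ^ 4 := by
  have h (q : R[X]) : ∃ r : R[X], q = C (q.eval x) + r * (X - C x) := by
    obtain ⟨r, hr⟩ := X_sub_C_dvd_sub_C_eval (a := x) (p := q)
    exact ⟨r, by linear_combination hr⟩
  obtain ⟨p₁, h₁⟩ := h p
  obtain ⟨p₂, h₂⟩ := h p₁
  obtain ⟨p₃, h₃⟩ := h p₂
  obtain ⟨p₄, h₄⟩ := h p₃
  have e : (derivative p).eval x = p₁.eval x := by
    conv_lhs => rw [h₁]
    simp
  refine ⟨p₂.eval x, p₃.eval x, p₄, ?_⟩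
  rw [e]
  linear_combination h₁ + (X - C x) * h₂ + (X - C x) ^ 2 * h₃ + (X - C x) ^ 3 * h₄

theorem apply_inv_of_mul_eq_one {E : Derivation ℂ R R} {x y i : R} (hi : i * (y - x) = 1) :
    E i = -i ^ 2 * (E y - E x) := by
  have h := congrArg E hi
  rw [Derivation.leibniz, Derivation.map_one_eq_zero, map_sub, smul_eq_mul, smul_eq_mul] at h
  linear_combination i * h - E i * hi

/-! ### Bracket of a Virasoro vector field with the Loewner vector field -/

section Drift

variable {D W : Derivation ℂ R R} {x : R} {n : ℤ} (hD : onCoeff D (fSeries a) = vRem a n)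
  (hDx : D x = (vPoly a n).eval x) (hW : onCoeff W (fSeries a) = 2 * fInv a x) (hWx : W x = 0)

include hW

/-- This is `bol_comp` for φ = 2/(f - x), whose successive derivatives in f are -2(f-x)⁻², 4(f-x)⁻³
and -12(f-x)⁻⁴. -/
theorem apply_res_schwarzian_of_loewner :
    W (res (upow R (1 - n) * schwarzian (fSeries a)))
      = -12 * res (upow R (1 - n) * (ddu (fSeries a) ^ 2 * fInv a x ^ 4)) := by
  have hG := ddu_fInv a x
  have h12 : (-12 : R) * res (upow R (1 - n) * (ddu (fSeries a) ^ 2 * fInv a x ^ 4))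
      = res (HahnSeries.C (-12) * (upow R (1 - n) * (ddu (fSeries a) ^ 2 * fInv a x ^ 4))) :=
    (res_const_mul _ _).symm
  have hC : (HahnSeries.C (-12 : R) : LaurentSeries R) = -12 := by rw [map_neg, map_ofNat]
  rw [← res_onCoeff, onCoeff_mul, onCoeff_upow, onCoeff_schwarzian, hW, h12, hC,
    bol_comp a (φ₁ := -2 * fInv a x ^ 2) (φ₂ := 4 * fInv a x ^ 3) (φ₃ := -12 * fInv a x ^ 4)]
  · congr 1
    ring
  · rw [ddu_mul, ddu_two, hG]; ring
  · rw [show (-2 * fInv a x ^ 2 : LaurentSeries R) = -(2 * (fInv a x * fInv a x)) by ring,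
      ddu_neg, ddu_mul, ddu_two, ddu_mul, hG]
    ring
  · rw [show (4 * fInv a x ^ 3 : LaurentSeries R)
      = 2 * (2 * (fInv a x * (fInv a x * fInv a x))) by ring,
      ddu_mul, ddu_two, ddu_mul, ddu_two, ddu_mul, ddu_mul, hG]
    ring

include hD hDx

/-- In the bracket applied to f, the terms singular at f = x combine to a simple pole, a multiple of
1/(f - x), plus a polynomial in f. All other terms being O(u⁻¹), that polynomial vanishes, which
determines how W acts on the coefficients of v_n and leaves the multiple -2v_n'(x). -/
theorem onCoeff_loewner_sub_and :
    (∃ (v₂ v₃ : R) (r : R[X]),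
      vPoly a n = C ((vPoly a n).eval x) + C ((derivative (vPoly a n)).eval x) * (X - C x)
        + C v₂ * (X - C x) ^ 2 + C v₃ * (X - C x) ^ 3 + r * (X - C x) ^ 4 ∧
      polyD W (vPoly a n) = -6 * C v₂ - 8 * C v₃ * (X - C x) - 10 * r * (X - C x) ^ 2
        - 2 * derivative r * (X - C x) ^ 3) ∧
    (X - C x) ^ 2 * polyD W (vPoly a n) = -2 * (vPoly a n - C ((vPoly a n).eval x))
      - 2 * derivative (vPoly a n) * (X - C x)
      + 4 * C ((derivative (vPoly a n)).eval x) * (X - C x) ∧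
    onCoeff D (2 * fInv a x) - onCoeff W (vRem a n)
      = HahnSeries.C (-2 * (derivative (vPoly a n)).eval x) * (2 * fInv a x) := by
  obtain ⟨v₂, v₃, r, hv⟩ := exists_taylor (vPoly a n) x
  generalize hv₀ : (vPoly a n).eval x = v₀ at hv hDx
  generalize hv₁ : (derivative (vPoly a n)).eval x = v₁ at hv
  -- This Q is the quotient by (X - x)² of -2(v - v₀) - 2v'·(X - x) + 4v₁(X - x), in which the
  -- linear terms cancel as -2 - 2 + 4 = 0.
  set Q : R[X] := -6 * C v₂ - 8 * C v₃ * (X - C x) - 10 * r * (X - C x) ^ 2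
        - 2 * derivative r * (X - C x) ^ 3 with hQ
  have hv' : derivative (vPoly a n) = C v₁ + 2 * C v₂ * (X - C x) + 3 * C v₃ * (X - C x) ^ 2
      + 4 * r * (X - C x) ^ 3 + derivative r * (X - C x) ^ 4 := by
    conv_lhs => rw [hv]
    have h2 : (C 2 : R[X]) = 2 := C_ofNat 2
    have h3 : (C 3 : R[X]) = 3 := C_ofNat 3
    have h4 : (C 4 : R[X]) = 4 := C_ofNat 4
    simp [derivative_pow, h2, h3, h4]
    ring
  have hA : (X - C x) ^ 2 * Q = -2 * (vPoly a n - C v₀) - 2 * derivative (vPoly a n) * (X - C x)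
      + 4 * C v₁ * (X - C x) := by
    rw [hQ, hv']
    conv_rhs => rw [hv]
    ring
  have hAF := congrArg (polyF a) hA
  have hF2 : polyF a 2 = 2 := by rw [← C_ofNat, polyF_C, map_ofNat]
  have hF4 : polyF a 4 = 4 := by rw [← C_ofNat, polyF_C, map_ofNat]
  have hC2 : (HahnSeries.C (-2 : R) : LaurentSeries R) = -2 := by rw [map_neg, map_ofNat]
  rw [pow_two, show (-2 : R[X]) = 0 - 2 by ring] at hAF
  simp only [polyF_mul, polyF_add, polyF_sub, polyF_X, polyF_C, hF2, hF4, polyF_zero] at hAF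
  have h0 := fSeries_sub_mul_fInv a x
  have hG := vanishesBelow_fInv a x
  have hWR := onCoeff_vRem (a := a) W n
  have hDG : onCoeff D (2 * fInv a x) = -2 * fInv a x ^ 2 * (vRem a n - HahnSeries.C v₀) := by
    rw [onCoeff_mul, onCoeff_two, onCoeff_fInv, hD, hDx]; ring
  rw [hW, ddu_mul, ddu_two, ddu_fInv] at hWR
  have key : onCoeff W (vRem a n) - onCoeff D (2 * fInv a x)
      - HahnSeries.C (2 * v₁) * (2 * fInv a x)
      = polyF a (polyD W (vPoly a n) - Q) := by
    rw [hWR, hDG, polyF_sub, vRem, map_mul, map_ofNat]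
    linear_combination fInv a x ^ 2 * hAF
      - (polyF a Q * ((fSeries a - HahnSeries.C x) * fInv a x + 1)
        + 2 * polyF a (derivative (vPoly a n)) * fInv a x - 4 * HahnSeries.C v₁ * fInv a x) * h0
  have hzero : polyD W (vPoly a n) - Q = 0 := by
    apply eq_zero_of_vanishesBelow_polyF a
    rw [← key]
    have h2G : VanishesBelow 1 (2 * fInv a x) := by
      rw [two_mul]; exact hG.add hG
    exact (((vanishesBelow_vRem a n).onCoeff W).sub (h2G.onCoeff D)).sub (h2G.const_mul _)
  refine ⟨⟨v₂, v₃, r, hv, sub_eq_zero.1 hzero⟩, by rw [sub_eq_zero.1 hzero, hA], ?_⟩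
  rw [hzero, ← C_0, polyF_C, map_zero] at key
  rw [map_mul, hC2]
  rw [map_mul, map_ofNat] at key
  linear_combination -key

theorem onCoeff_loewner_sub :
    onCoeff D (2 * fInv a x) - onCoeff W (vRem a n)
      = HahnSeries.C (-2 * (derivative (vPoly a n)).eval x) * (2 * fInv a x) :=
  (onCoeff_loewner_sub_and hD hDx hW).2.2

/-- The compatibility of the two vector fields at a point `y ≠ x`. -/
theorem apply_loewner_sub {y i : R} (hi : i * (y - x) = 1) (hDy : D y = (vPoly a n).eval y)
    (hWy : W y = 2 * i) :
    D (2 * i) - W ((vPoly a n).eval y) = -2 * (derivative (vPoly a n)).eval x * (2 * i) := by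
  obtain ⟨-, hA, -⟩ := onCoeff_loewner_sub_and hD hDx hW
  have hAy := congrArg (eval y) hA
  simp only [eval_mul, eval_add, eval_sub, eval_pow, eval_X, eval_C, eval_neg, eval_ofNat] at hAy
  rw [apply_eval, hWy, two_mul i, map_add, apply_inv_of_mul_eq_one hi, hDx, hDy]
  linear_combination (-i ^ 2) * hAy
    + (eval y (polyD W (vPoly a n)) * (i * (y - x) + 1)
      + 2 * eval y (derivative (vPoly a n)) * i - 4 * eval x (derivative (vPoly a n)) * i) * hi

/-- This is the y-derivative of the compatibility at y: -2/(y-x)² is the derivative of 2/(y-x), and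
v' that of v. Hence both the polynomial identity for W and its derivative at y enter. -/
theorem apply_weight_loewner_sub {y i : R} (hi : i * (y - x) = 1)
    (hDy : D y = (vPoly a n).eval y) (hWy : W y = 2 * i) :
    D (-2 * i ^ 2) - W ((derivative (vPoly a n)).eval y)
      = -2 * (derivative (vPoly a n)).eval x * (-2 * i ^ 2) := by
  obtain ⟨-, hA, -⟩ := onCoeff_loewner_sub_and hD hDx hW
  have hAy := congrArg (eval y) hA
  have hBy := congrArg (fun p => eval y (derivative p)) hA
  simp only [eval_mul, eval_add, eval_sub, eval_pow, eval_X, eval_C, eval_neg, eval_ofNat] at hAy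
  have d2 : derivative (-2 : R[X]) = 0 := by rw [derivative_neg, derivative_ofNat, neg_zero]
  simp only [pow_two, derivative_mul, derivative_add, derivative_sub, derivative_X, derivative_C,
    d2, derivative_ofNat, eval_mul, eval_add, eval_sub, eval_X, eval_C, eval_neg, eval_ofNat,
    eval_one, eval_zero] at hBy
  have hsq : D (-2 * i ^ 2) = -4 * i * D i := by
    rw [show (-2 * i ^ 2 : R) = -(i * i + i * i) by ring, map_neg, map_add, Derivation.leibniz,
      smul_eq_mul]
    ring
  rw [hsq, apply_eval, ← derivative_polyD, hWy, apply_inv_of_mul_eq_one hi, hDx, hDy]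
  linear_combination (-i ^ 2) * hBy + 2 * i ^ 3 * hAy
    + (eval y (derivative (polyD W (vPoly a n))) * (i * (y - x) + 1)
      - 2 * i ^ 2 * (y - x) * eval y (polyD W (vPoly a n))
      - 4 * eval y (derivative (vPoly a n)) * i ^ 2
      + 2 * i * eval y (derivative (derivative (vPoly a n)))
      + 8 * eval x (derivative (vPoly a n)) * i ^ 2) * hi

include hWx

/-- At the singular point x itself W moves only the coefficients of v_n, so the value is that of the
explicit quotient at x, namely -6v₂ with v'' = 2v₂. -/
theorem apply_eval_vPoly_of_loewner :
    W ((vPoly a n).eval x) = -3 * (derivative (derivative (vPoly a n))).eval x := by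
  obtain ⟨⟨v₂, v₃, r, hv, hQ⟩, -⟩ := onCoeff_loewner_sub_and hD hDx hW
  have h2 : (derivative (derivative (vPoly a n))).eval x = 2 * v₂ := by
    rw [hv]; simp [derivative_pow]; ring
  rw [apply_eval, hWx, hQ, h2]
  simp
  ring

/-- Here the derivative of the quotient at x is -8v₃ while v''' = 6v₃; the factor 3 avoids a
division. -/
theorem apply_eval_derivative_vPoly_of_loewner :
    3 * W ((derivative (vPoly a n)).eval x)
      = -4 * (derivative (derivative (derivative (vPoly a n)))).eval x := by
  obtain ⟨⟨v₂, v₃, r, hv, hQ⟩, -⟩ := onCoeff_loewner_sub_and hD hDx hW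
  have h3 : (derivative (derivative (derivative (vPoly a n)))).eval x = 6 * v₃ := by
    rw [hv]; simp [derivative_pow]; ring
  rw [apply_eval, hWx, ← derivative_polyD, hQ, h3]
  simp [derivative_pow]
  ring

end Drift

end Loewner

/-! ### Derivations of the algebra of SLE data -/

section SmoothFunctions

variable {N M : ℕ} {p₀ : Fin N ⊕ Fin M → ℝ} (hp₀ : Function.Injective p₀)

theorem contDiffAt_extendZero (hp₀ : Function.Injective p₀) (φ : Smooth p₀) (p : orderedSet p₀) :
    ContDiffAt ℝ ∞ (extendZero φ.1) p.1 :=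
  ContDiffOn.contDiffAt φ.2 ((isOpen_orderedSet hp₀).mem_nhds p.2)

theorem differentiableAt_extendZero (hp₀ : Function.Injective p₀) (φ : Smooth p₀)
    (p : orderedSet p₀) : DifferentiableAt ℝ (extendZero φ.1) p.1 :=
  (contDiffAt_extendZero hp₀ φ p).differentiableAt (by simp)

theorem partialDeriv_apply (i : Fin N ⊕ Fin M) (φ : Smooth p₀) (p : orderedSet p₀) :
    (partialDeriv hp₀ i φ).1 p = fderiv ℝ (extendZero φ.1) p.1 (Pi.single i 1) := rfl

theorem partialDeriv_mul (i : Fin N ⊕ Fin M) (φ ψ : Smooth p₀) :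
    partialDeriv hp₀ i (φ * ψ) = φ * partialDeriv hp₀ i ψ + ψ * partialDeriv hp₀ i φ := by
  ext p
  have he : extendZero (φ * ψ).1 =ᶠ[nhds p.1] extendZero φ.1 * extendZero ψ.1 := by
    filter_upwards [(isOpen_orderedSet hp₀).mem_nhds p.2] with x hx
    simp [extendZero_apply _ hx]
  change (partialDeriv hp₀ i (φ * ψ)).1 p = φ.1 p * (partialDeriv hp₀ i ψ).1 p
    + ψ.1 p * (partialDeriv hp₀ i φ).1 p
  rw [partialDeriv_apply, partialDeriv_apply, partialDeriv_apply, he.fderiv_eq,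
    fderiv_mul (differentiableAt_extendZero hp₀ φ p) (differentiableAt_extendZero hp₀ ψ p)]
  simp [extendZero_apply _ p.2]

theorem partialDeriv_comm (i j : Fin N ⊕ Fin M) (φ : Smooth p₀) :
    partialDeriv hp₀ i (partialDeriv hp₀ j φ) = partialDeriv hp₀ j (partialDeriv hp₀ i φ) := by
  ext p
  have h2 : ContDiffOn ℝ ∞ (fderiv ℝ (extendZero φ.1)) (orderedSet p₀) :=
    ContDiffOn.fderiv_of_isOpen φ.2 (isOpen_orderedSet hp₀) (by simp)
  have hd : DifferentiableAt ℝ (fderiv ℝ (extendZero φ.1)) p.1 :=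
    (h2.contDiffAt ((isOpen_orderedSet hp₀).mem_nhds p.2)).differentiableAt (by simp)
  have key (i j : Fin N ⊕ Fin M) : (partialDeriv hp₀ i (partialDeriv hp₀ j φ)).1 p
      = fderiv ℝ (fderiv ℝ (extendZero φ.1)) p.1 (Pi.single i 1) (Pi.single j 1) := by
    have he : extendZero (partialDeriv hp₀ j φ).1 =ᶠ[nhds p.1]
        fun x => fderiv ℝ (extendZero φ.1) x (Pi.single j 1) := by
      filter_upwards [(isOpen_orderedSet hp₀).mem_nhds p.2] with x hx
      rw [extendZero_apply _ hx, partialDeriv_apply]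
    rw [partialDeriv_apply, he.fderiv_eq, fderiv_clm_apply hd (differentiableAt_const _)]
    simp
  change (partialDeriv hp₀ i (partialDeriv hp₀ j φ)).1 p
    = (partialDeriv hp₀ j (partialDeriv hp₀ i φ)).1 p
  rw [key, key]
  exact ((contDiffAt_extendZero hp₀ φ p).isSymmSndFDerivAt
    (by
      rw [minSmoothness_of_isRCLikeNormedField]
      exact WithTop.coe_le_coe.2 (le_top : (2 : ℕ∞) ≤ ⊤))).eq _ _

theorem partialDeriv_coord (i j : Fin N ⊕ Fin M) :
    partialDeriv hp₀ i (coord p₀ j) = if i = j then 1 else 0 := by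
  ext p
  have he : extendZero (coord p₀ j).1 =ᶠ[nhds p.1]
      fun x => (Complex.ofRealCLM.comp (ContinuousLinearMap.proj j)) x := by
    filter_upwards [(isOpen_orderedSet hp₀).mem_nhds p.2] with x hx
    rw [extendZero_apply _ hx]
    rfl
  change (partialDeriv hp₀ i (coord p₀ j)).1 p = _
  rw [partialDeriv_apply, he.fderiv_eq, ContinuousLinearMap.fderiv]
  by_cases h : i = j
  · subst h; simp
  · simp [h]

theorem invDiff_mul {i j : Fin N ⊕ Fin M} (hij : i ≠ j) :
    invDiff hp₀ i j * (coord p₀ j - coord p₀ i) = 1 := by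
  ext p
  change ((p.1 j : ℂ) - (p.1 i : ℂ))⁻¹ * ((p.1 j : ℂ) - (p.1 i : ℂ)) = 1
  rw [inv_mul_cancel₀]
  rw [sub_ne_zero]
  exact_mod_cast fun h' => hij (injective_of_mem hp₀ p.2 h').symm

end SmoothFunctions

/-! ### Vector fields on the algebra of SLE data -/

section SLEDataDerivations

variable {N M : ℕ} {p₀ : Fin N ⊕ Fin M → ℝ} (hp₀ : Function.Injective p₀)

theorem const_add (φ ψ : Smooth p₀) : const (φ + ψ) = const φ + const ψ :=
  map_add (MvPolynomial.C : Smooth p₀ →+* MvPolynomial ℕ (Smooth p₀)) φ ψ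
theorem const_sub (φ ψ : Smooth p₀) : const (φ - ψ) = const φ - const ψ :=
  map_sub (MvPolynomial.C : Smooth p₀ →+* MvPolynomial ℕ (Smooth p₀)) φ ψ
theorem const_mul (φ ψ : Smooth p₀) : const (φ * ψ) = const φ * const ψ :=
  map_mul (MvPolynomial.C : Smooth p₀ →+* MvPolynomial ℕ (Smooth p₀)) φ ψ
theorem const_pow (φ : Smooth p₀) (n : ℕ) : const (φ ^ n) = const φ ^ n :=
  map_pow (MvPolynomial.C : Smooth p₀ →+* MvPolynomial ℕ (Smooth p₀)) φ n
theorem const_one : const (1 : Smooth p₀) = 1 :=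
  map_one (MvPolynomial.C : Smooth p₀ →+* MvPolynomial ℕ (Smooth p₀))
theorem const_zero : const (0 : Smooth p₀) = 0 :=
  map_zero (MvPolynomial.C : Smooth p₀ →+* MvPolynomial ℕ (Smooth p₀))
theorem const_two : const (2 : Smooth p₀) = 2 :=
  map_ofNat (MvPolynomial.C : Smooth p₀ →+* MvPolynomial ℕ (Smooth p₀)) 2

/-- Induction on elements of `ℱ`. -/
theorem SLEData.induction {p : SLEData p₀ → Prop} (hC : ∀ φ, p (const φ))
    (hadd : ∀ η ξ, p η → p ξ → p (η + ξ)) (hX : ∀ η k, p η → p (η * fVar p₀ k)) (η : SLEData p₀) :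
    p η :=
  MvPolynomial.induction_on (motive := p) η hC hadd hX

theorem coeff_dX (i : Fin N ⊕ Fin M) (η : SLEData p₀) (m : ℕ →₀ ℕ) :
    MvPolynomial.coeff m (dX hp₀ i η : MvPolynomial ℕ (Smooth p₀))
      = partialDeriv hp₀ i (MvPolynomial.coeff m (η : MvPolynomial ℕ (Smooth p₀))) := rfl

theorem dX_const (i : Fin N ⊕ Fin M) (φ : Smooth p₀) :
    dX hp₀ i (const φ) = const (partialDeriv hp₀ i φ) := by
  apply MvPolynomial.ext
  intro m
  rw [coeff_dX, const, const, MvPolynomial.coeff_C, MvPolynomial.coeff_C]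
  split_ifs
  · rfl
  · rw [map_zero]

theorem dX_mul_fVar (i : Fin N ⊕ Fin M) (η : SLEData p₀) (k : ℕ) :
    dX hp₀ i (η * fVar p₀ k) = dX hp₀ i η * fVar p₀ k := by
  apply MvPolynomial.ext
  intro m
  rw [coeff_dX]
  refine (congrArg (partialDeriv hp₀ i) (MvPolynomial.coeff_mul_X' m k η)).trans
    (Eq.trans ?_ (MvPolynomial.coeff_mul_X' m k (dX hp₀ i η)).symm)
  split_ifs
  · rfl
  · rw [map_zero]

theorem dX_mul (i : Fin N ⊕ Fin M) (η ξ : SLEData p₀) :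
    dX hp₀ i (η * ξ) = η * dX hp₀ i ξ + ξ * dX hp₀ i η := by
  induction η using SLEData.induction with
  | hC φ =>
    induction ξ using SLEData.induction with
    | hC ψ => rw [← const_mul, dX_const, dX_const, dX_const, partialDeriv_mul, const_add, const_mul,
        const_mul]
    | hadd η ξ h h' => rw [mul_add, map_add, map_add, h, h']; ring
    | hX η k h => rw [← mul_assoc, dX_mul_fVar, dX_mul_fVar, h]; ring
  | hadd η ξ h h' => rw [add_mul, map_add, map_add, h, h']; ring
  | hX η k h =>
    rw [show η * fVar p₀ k * ξ = η * ξ * fVar p₀ k by ring, dX_mul_fVar, dX_mul_fVar, h]; ring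

/-- The partial derivative with respect to the `i`-th coordinate, as a derivation. -/
def dXDer (i : Fin N ⊕ Fin M) : Derivation ℂ (SLEData p₀) (SLEData p₀) :=
  Derivation.mk' (dX hp₀ i) fun η ξ => dX_mul hp₀ i η ξ

theorem dXDer_apply (i : Fin N ⊕ Fin M) (η : SLEData p₀) : dXDer hp₀ i η = dX hp₀ i η := rfl

theorem dF_mul (b : ℕ → SLEData p₀) (η ξ : SLEData p₀) :
    dF b (η * ξ) = η * dF b ξ + ξ * dF b η :=
  Derivation.leibniz (MvPolynomial.mkDerivation (Smooth p₀) b :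
    Derivation (Smooth p₀) (MvPolynomial ℕ (Smooth p₀)) (MvPolynomial ℕ (Smooth p₀))) η ξ

theorem dF_const (b : ℕ → SLEData p₀) (φ : Smooth p₀) : dF b (const φ) = 0 :=
  Derivation.map_algebraMap (MvPolynomial.mkDerivation (Smooth p₀) b :
    Derivation (Smooth p₀) (MvPolynomial ℕ (Smooth p₀)) (MvPolynomial ℕ (Smooth p₀))) φ

theorem dF_fVar (b : ℕ → SLEData p₀) (k : ℕ) : dF b (fVar p₀ k) = b k :=
  MvPolynomial.mkDerivation_X (A := MvPolynomial ℕ (Smooth p₀)) (Smooth p₀) b k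

theorem dX_fVar (i : Fin N ⊕ Fin M) (k : ℕ) : dX hp₀ i (fVar p₀ k) = 0 := by
  have h := dX_mul_fVar hp₀ i 1 k
  rwa [one_mul, ← const_one, dX_const, ← dXDer_apply, show partialDeriv hp₀ i 1 = 0 from ?_,
    const_zero, zero_mul] at h
  have := partialDeriv_mul hp₀ i 1 1
  rw [one_mul, one_mul] at this
  exact left_eq_add.1 this

/-- The derivation `∑_{m ≤ -2} b_m ∂/∂f_m`. -/
def dFDer (b : ℕ → SLEData p₀) : Derivation ℂ (SLEData p₀) (SLEData p₀) :=
  Derivation.mk' (dF b) fun η ξ => dF_mul b η ξ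

/-- The derivation `∑_i α_i ∂/∂p_i + ∑_{m ≤ -2} b_m ∂/∂f_m`. -/
def vectorField (α : Fin N ⊕ Fin M → SLEData p₀) (b : ℕ → SLEData p₀) :
    Derivation ℂ (SLEData p₀) (SLEData p₀) :=
  ∑ i, α i • dXDer hp₀ i + dFDer b

theorem vectorField_apply (α : Fin N ⊕ Fin M → SLEData p₀) (b : ℕ → SLEData p₀) (η : SLEData p₀) :
    vectorField hp₀ α b η = ∑ i, α i * dX hp₀ i η + dF b η := by
  rw [vectorField, Derivation.add_apply, ← Derivation.coeFnAddMonoidHom_apply, map_sum,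
    Finset.sum_apply]
  rfl

theorem vectorField_const (α : Fin N ⊕ Fin M → SLEData p₀) (b : ℕ → SLEData p₀) (φ : Smooth p₀) :
    vectorField hp₀ α b (const φ) = ∑ i, α i * const (partialDeriv hp₀ i φ) := by
  rw [vectorField_apply, dF_const, add_zero]
  simp only [dX_const]

theorem vectorField_coord (α : Fin N ⊕ Fin M → SLEData p₀) (b : ℕ → SLEData p₀)
    (i : Fin N ⊕ Fin M) : vectorField hp₀ α b (const (coord p₀ i)) = α i := by
  rw [vectorField_const, Finset.sum_eq_single i]
  · rw [partialDeriv_coord, if_pos rfl, const_one, mul_one]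
  · intro j _ hj
    rw [partialDeriv_coord, if_neg hj, const_zero, mul_zero]
  · simp

theorem vectorField_fVar (α : Fin N ⊕ Fin M → SLEData p₀) (b : ℕ → SLEData p₀) (k : ℕ) :
    vectorField hp₀ α b (fVar p₀ k) = b k := by
  rw [vectorField_apply, dF_fVar]
  simp [dX_fVar]

theorem derivation_ext {D E : Derivation ℂ (SLEData p₀) (SLEData p₀)}
    (hC : ∀ φ, D (const φ) = E (const φ)) (hX : ∀ k, D (fVar p₀ k) = E (fVar p₀ k)) : D = E := by
  ext η
  induction η using SLEData.induction with
  | hC φ => exact hC φ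
  | hadd η ξ h h' => rw [map_add, map_add, h, h']
  | hX η k h => rw [Derivation.leibniz, Derivation.leibniz, h, hX]

theorem dXDer_eq_vectorField (i : Fin N ⊕ Fin M) :
    dXDer hp₀ i = vectorField hp₀ (Pi.single i 1) 0 := by
  refine derivation_ext (fun φ => ?_) fun k => ?_
  · rw [vectorField_const, Finset.sum_eq_single i, Pi.single_eq_same, one_mul, dXDer_apply,
      dX_const]
    · intro j _ hj
      rw [Pi.single_eq_of_ne hj, zero_mul]
    · simp
  · rw [vectorField_fVar, dXDer_apply, dX_fVar, Pi.zero_apply]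

theorem vectorField_congr {α α' : Fin N ⊕ Fin M → SLEData p₀} {b b' : ℕ → SLEData p₀}
    (hα : ∀ i, α i = α' i) (hb : ∀ k, b k = b' k) :
    vectorField hp₀ α b = vectorField hp₀ α' b' := by
  rw [funext hα, funext hb]

/-- Second order terms cancel because partial derivatives commute. The bracket is therefore again a
vector field, and bracket identities reduce to the components at the p_i and the f_m. -/
theorem vectorField_bracket (α α' : Fin N ⊕ Fin M → SLEData p₀) (b b' : ℕ → SLEData p₀) :
    ⁅vectorField hp₀ α b, vectorField hp₀ α' b'⁆
      = vectorField hp₀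
        (fun i => vectorField hp₀ α b (α' i) - vectorField hp₀ α' b' (α i))
        (fun k => vectorField hp₀ α b (b' k) - vectorField hp₀ α' b' (b k)) := by
  refine derivation_ext (fun φ => ?_) fun k => ?_
  · rw [Derivation.commutator_apply, vectorField_const, vectorField_const, vectorField_const,
      map_sum, map_sum]
    simp only [Derivation.leibniz, smul_eq_mul, vectorField_const, Finset.mul_sum, sub_mul,
      Finset.sum_add_distrib, Finset.sum_sub_distrib]
    have h : ∑ i, ∑ j, α' i * (α j * const (partialDeriv hp₀ j (partialDeriv hp₀ i φ)))
        = ∑ i, ∑ j, α i * (α' j * const (partialDeriv hp₀ j (partialDeriv hp₀ i φ))) := by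
      rw [Finset.sum_comm]
      refine Finset.sum_congr rfl fun i _ => Finset.sum_congr rfl fun j _ => ?_
      rw [partialDeriv_comm]
      ring
    rw [h]
    simp only [mul_comm (const _)]
    ring
  · rw [Derivation.commutator_apply, vectorField_fVar, vectorField_fVar, vectorField_fVar]

theorem vectorField_smul (r : SLEData p₀) (α : Fin N ⊕ Fin M → SLEData p₀) (b : ℕ → SLEData p₀) :
    r • vectorField hp₀ α b = vectorField hp₀ (fun i => r * α i) (fun k => r * b k) := by
  refine derivation_ext (fun φ => ?_) fun k => ?_
  · rw [Derivation.smul_apply, vectorField_const, vectorField_const, smul_eq_mul, Finset.mul_sum]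
    simp only [mul_assoc]
  · rw [Derivation.smul_apply, vectorField_fVar, vectorField_fVar, smul_eq_mul]

theorem vectorField_add (α α' : Fin N ⊕ Fin M → SLEData p₀) (b b' : ℕ → SLEData p₀) :
    vectorField hp₀ α b + vectorField hp₀ α' b'
      = vectorField hp₀ (fun i => α i + α' i) (fun k => b k + b' k) := by
  refine derivation_ext (fun φ => ?_) fun k => ?_
  · rw [Derivation.add_apply, vectorField_const, vectorField_const, vectorField_const,
      ← Finset.sum_add_distrib]
    simp only [add_mul]
  · rw [Derivation.add_apply, vectorField_fVar, vectorField_fVar, vectorField_fVar]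

end SLEDataDerivations

/-! ### The universal polynomials -/

section Universal

open MvPolynomial

/-- A Laurent series over the ring of polynomials in `x, f_{-2}, f_{-3}, …` is homogeneous of
degree `d` if it is so when `u` has degree `1`. -/
def IsHomogeneousSeries (d : ℤ) (s : LaurentSeries (MvPolynomial (Option ℕ) ℂ)) : Prop :=
  ∀ k : ℤ, IsWeightedHomogeneous varDegree (s.coeff k) (d + k)

namespace IsHomogeneousSeries

variable {d e : ℤ} {s t : LaurentSeries (MvPolynomial (Option ℕ) ℂ)}

theorem mul (hs : IsHomogeneousSeries d s) (ht : IsHomogeneousSeries e t) :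
    IsHomogeneousSeries (d + e) (s * t) := by
  intro k
  rw [HahnSeries.coeff_mul]
  refine IsWeightedHomogeneous.sum _ _ _ fun ij hij => ?_
  have h3 := (Finset.mem_antidiagonal.1 hij).2.2
  have := (hs ij.1).mul (ht ij.2)
  rwa [show d + ij.1 + (e + ij.2) = d + e + k by rw [← h3]; ring] at this

theorem sub (hs : IsHomogeneousSeries d s) (ht : IsHomogeneousSeries d t) :
    IsHomogeneousSeries d (s - t) := fun k => by
  rw [HahnSeries.coeff_sub]
  exact (hs k).sub (ht k)

theorem single {k : ℤ} {r : MvPolynomial (Option ℕ) ℂ}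
    (h : IsWeightedHomogeneous varDegree r (d + k)) :
    IsHomogeneousSeries d (HahnSeries.single k r) := fun j => by
  rw [HahnSeries.coeff_single]
  split_ifs with hj
  · rwa [hj]
  · exact isWeightedHomogeneous_zero _ _ _

theorem upow (k : ℤ) : IsHomogeneousSeries k (upow _ k) :=
  single (by rw [add_neg_cancel]; exact isWeightedHomogeneous_one _ _)

theorem one : IsHomogeneousSeries 0 1 := single (isWeightedHomogeneous_one _ _)

theorem pow (hs : IsHomogeneousSeries d s) (n : ℕ) : IsHomogeneousSeries (n * d) (s ^ n) := by
  induction n with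
  | zero => simpa using one
  | succ n ih =>
    have := ih.mul hs
    rwa [← pow_succ, show (n : ℤ) * d + d = (n + 1 : ℕ) * d by push_cast; ring] at this

theorem ddu (hs : IsHomogeneousSeries d s) : IsHomogeneousSeries (d - 1) (ddu s) := fun k => by
  rw [coeff_ddu]
  have h := hs (k - 1)
  rw [show d + (k - 1) = d - 1 + k by ring] at h
  have h2 := ((weightedHomogeneousSubmodule ℂ varDegree (d - 1 + k)).toAddSubgroup.zsmul_mem
    (x := s.coeff (k - 1)) h (k - 1))
  exact IsWeightedHomogeneous.neg h2

theorem fSeries :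
    IsHomogeneousSeries 1 (fSeries fun k => (X (some k) : MvPolynomial (Option ℕ) ℂ)) := by
  intro k
  rcases le_or_gt k (-1) with h | h
  · rw [coeff_fSeries_of_neg _ h]
    split_ifs with h1
    · subst h1; exact isWeightedHomogeneous_one _ _
    · exact isWeightedHomogeneous_zero _ _ _
  · rcases eq_or_ne k 0 with h0 | h0
    · subst h0
      rw [coeff_zero_fSeries]
      exact isWeightedHomogeneous_zero _ _ _
    · obtain ⟨j, rfl⟩ : ∃ j : ℕ, k = j + 1 := ⟨(k - 1).toNat, by lia⟩
      rw [coeff_fSeries_natCast_add_one, show (1 : ℤ) + (j + 1) = varDegree (some j) by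
        rw [varDegree]; ring]
      exact isWeightedHomogeneous_X _ _ _

/-- With g = 1 - u⁻¹(f - x), homogeneous of degree 0 and of order at least 1, the inverse satisfies
G = u⁻¹ + gG. Iteration writes G as a homogeneous partial sum plus g^K G. -/
theorem fInv : IsHomogeneousSeries (-1)
    (fInv (fun k => (X (some k) : MvPolynomial (Option ℕ) ℂ)) (X none)) := by
  set a : ℕ → MvPolynomial (Option ℕ) ℂ := fun k => X (some k) with ha
  set x : MvPolynomial (Option ℕ) ℂ := X none
  set G := SLE.fInv a x
  set u := SLE.upow (MvPolynomial (Option ℕ) ℂ) (-1)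
  have hx : IsHomogeneousSeries 1 (SLE.fSeries a - HahnSeries.C x) := by
    refine fSeries.sub (single ?_)
    have := isWeightedHomogeneous_X ℂ varDegree none
    exact this
  set g := 1 - u * (SLE.fSeries a - HahnSeries.C x)
  have hg : IsHomogeneousSeries 0 g := one.sub ((upow (-1)).mul hx)
  have hG : G = u + g * G := by
    linear_combination u * fSeries_sub_mul_fInv a x
  have hVg : VanishesBelow 1 g := by
    intro k hk
    have h1 : g.coeff k = (1 : LaurentSeries (MvPolynomial (Option ℕ) ℂ)).coeff k
        - ((SLE.fSeries a).coeff (k - 1) - (HahnSeries.C x : LaurentSeries _).coeff (k - 1)) := by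
      rw [HahnSeries.coeff_sub, coeff_upow_mul, HahnSeries.coeff_sub, sub_eq_add_neg k]
    rw [h1, HahnSeries.C_apply, HahnSeries.coeff_single, if_neg (by lia),
      coeff_fSeries_of_neg a (by lia), HahnSeries.coeff_one]
    by_cases h : k = 0
    · rw [if_pos h, if_pos (by lia)]; ring
    · rw [if_neg h, if_neg (by lia)]; ring
  have key (K : ℕ) : ∃ s, IsHomogeneousSeries (-1) s ∧ G = s + g ^ K * G := by
    induction K with
    | zero => exact ⟨0, fun k => isWeightedHomogeneous_zero _ _ _, by ring⟩
    | succ K ih =>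
      obtain ⟨s, hs, hsG⟩ := ih
      refine ⟨s + g ^ K * u, fun k => (hs k).add ?_, ?_⟩
      · have := ((hg.pow K).mul (upow (-1))) k
        rwa [mul_zero, zero_add] at this
      · linear_combination hsG + g ^ K * hG
  intro k
  -- The remainder g^K G has order at least K + 1, so K = k.toNat makes it invisible at index k.
  obtain ⟨s, hs, hsG⟩ := key k.toNat
  rw [hsG, HahnSeries.coeff_add]
  have h := (hVg.pow k.toNat).mul (vanishesBelow_fInv a x)
  rw [h k (by lia), add_zero]
  exact hs k

end IsHomogeneousSeries

/-- The polynomial `q_n(x; f_{-2}, f_{-3}, …) = -2 Res_u u^(1-n) f'(u)² (f(u) - x)⁻²`. -/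
def qPoly (n : ℤ) : MvPolynomial (Option ℕ) ℂ :=
  C (-2) * res (upow _ (1 - n) * (ddu (fSeries fun k => X (some k)) ^ 2
    * fInv (fun k => X (some k)) (X none) ^ 2))

/-- Degree count: u^(1-n) has degree 1 - n, f' has degree 0, (f - x)⁻² has degree -2, and taking the
residue adds 1. -/
theorem isWeightedHomogeneous_qPoly (n : ℤ) : IsWeightedHomogeneous varDegree (qPoly n) (-n) := by
  have h := ((IsHomogeneousSeries.upow (1 - n)).mul
    ((IsHomogeneousSeries.fSeries.ddu.pow 2).mul (IsHomogeneousSeries.fInv.pow 2))) 1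
  have h2 := (isWeightedHomogeneous_C varDegree (-2 : ℂ)).mul h
  have e : 0 + ((1 - n + (((2 : ℕ) : ℤ) * (1 - 1) + ((2 : ℕ) : ℤ) * -1)) + 1) = -n := by
    push_cast; ring
  rw [e] at h2
  exact h2

theorem qPoly_eq_zero {n : ℤ} (hn : 0 < n) : qPoly n = 0 := by
  rw [qPoly, VanishesBelow.res_eq_zero
    (vanishesBelow_vCoeff_arg _ n ((vanishesBelow_fInv _ _).pow 2)) (by push_cast; lia), mul_zero]

theorem evalAt_qPoly {N M : ℕ} (p₀ : Fin N ⊕ Fin M → ℝ) (I : Fin N) (n : ℤ) :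
    evalAt p₀ I (qPoly n) = -2 * res (upow _ (1 - n) * (ddu (fSeries (fVar p₀)) ^ 2
      * fInv (fVar p₀) (const (coord p₀ (Sum.inl I))) ^ 2)) := by
  let φ : MvPolynomial (Option ℕ) ℂ →+* SLEData p₀ := (aeval
    (fun o : Option ℕ => o.elim (const (coord p₀ (Sum.inl I))) (fVar p₀)) :
      MvPolynomial (Option ℕ) ℂ →ₐ[ℂ] SLEData p₀)
  have hs (k : ℕ) : φ (X (some k)) = fVar p₀ k := aeval_X _ _
  have hn : φ (X none) = const (coord p₀ (Sum.inl I)) := aeval_X _ _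
  change φ (qPoly n) = _
  have hc : φ (C (-2)) = -2 := by
    rw [C_neg, map_neg, map_ofNat, map_ofNat]
  rw [qPoly, map_mul, hc, ← res_mapHom, map_mul, map_mul, map_pow, map_pow, mapHom_upow, mapHom_ddu,
    mapHom_fSeries, mapHom_fInv, hn]
  simp only [hs]

end Universal

/-! ### Commutators of differential operators -/

section Commutators

variable {R : Type*} [CommRing R] [Algebra ℂ R]

/-- The commutator of a first order operator with a second order operator whose leading part
is a multiple of `P²`. -/
theorem commutator_eq_mul {D P W : Derivation ℂ R R} {s : ℂ} {h ρ m v₁ v₂ v₃ : R}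
    (hDP : ⁅D, P⁆ = -(v₁ • P)) (hDW : ⁅D, W⁆ = (-2 * v₁) • W + (3 * v₂) • P)
    (hρ : P ρ = h * v₂) (hh : P h = 0) (hv₁ : P v₁ = v₂) (hv₂ : P v₂ = v₃)
    (hs : algebraMap ℂ R s * (1 + 2 * h) = 3)
    (hm : D m - W ρ - algebraMap ℂ R s * (h * v₃) = -2 * v₁ * m) (η : R) :
    (D (s • P (P η) + W η + m * η) + ρ * (s • P (P η) + W η + m * η))
      - (s • P (P (D η + ρ * η)) + W (D η + ρ * η) + m * (D η + ρ * η))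
      = -2 * v₁ * (s • P (P η) + W η + m * η) := by
  have hDP' (ξ : R) : D (P ξ) = P (D ξ) - v₁ * P ξ := by
    have := congrArg (fun E : Derivation ℂ R R => E ξ) hDP
    simp only [Derivation.commutator_apply, Derivation.neg_apply, Derivation.smul_apply,
      smul_eq_mul] at this
    linear_combination this
  have hDW' : D (W η) = W (D η) + (-2 * v₁) * W η + 3 * v₂ * P η := by
    have := congrArg (fun E : Derivation ℂ R R => E η) hDW
    simp only [Derivation.commutator_apply, Derivation.add_apply, Derivation.smul_apply,
      smul_eq_mul] at this
    linear_combination this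
  have hsm (ξ : R) : s • ξ = algebraMap ℂ R s * ξ := Algebra.smul_def _ _
  simp only [hsm, map_add, Derivation.leibniz, smul_eq_mul, hDP', hDW', hρ, hh, hv₂,
    map_sub, hv₁, Derivation.map_algebraMap]
  -- The P² and W terms already match. The coefficient of Pη is v₂(3 - s(1 + 2h)), and the multiple
  -- of η is the relation `hm`.
  linear_combination η * hm - v₂ * P η * hs

end Commutators

/-! ### The operators `ℒ_n` and `𝒜_I` -/

section Operators

open Polynomial

variable {N M : ℕ} {p₀ : Fin N ⊕ Fin M → ℝ} (hp₀ : Function.Injective p₀)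

theorem mulOp_apply (η ξ : SLEData p₀) : mulOp η ξ = η * ξ := rfl

/-- The coordinate `p_i` as an element of `ℱ`. -/
def pt (p₀ : Fin N ⊕ Fin M → ℝ) (i : Fin N ⊕ Fin M) : SLEData p₀ := const (coord p₀ i)

theorem dX_pt (i j : Fin N ⊕ Fin M) : dX hp₀ i (pt p₀ j) = if i = j then 1 else 0 := by
  rw [pt, dX_const, partialDeriv_coord]
  split_ifs
  · exact const_one
  · exact const_zero

theorem dXDer_pt_self (i : Fin N ⊕ Fin M) : dXDer hp₀ i (pt p₀ i) = 1 := by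
  rw [dXDer_apply, dX_pt, if_pos rfl]

theorem dXDer_fVar (i : Fin N ⊕ Fin M) (k : ℕ) : dXDer hp₀ i (fVar p₀ k) = 0 := dX_fVar hp₀ i k

/-- The first order part of `ℒ_n`. -/
def virDer (n : ℤ) : Derivation ℂ (SLEData p₀) (SLEData p₀) :=
  vectorField hp₀ (fun i => (vPoly (fVar p₀) n).eval (pt p₀ i))
    (fun k => (vRem (fVar p₀) n).coeff (k + 1))

/-- The part of order zero of `ℒ_n`. -/
def virWeight (p₀ : Fin N ⊕ Fin M → ℝ) (c : ℂ) (δ : Fin N ⊕ Fin M → ℂ) (n : ℤ) : SLEData p₀ :=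
  algebraMap ℂ _ (c / 12) * res (upow _ (1 - n) * schwarzian (fSeries (fVar p₀)))
    + ∑ i, algebraMap ℂ _ (δ i) * (derivative (vPoly (fVar p₀) n)).eval (pt p₀ i)

theorem smul_eq_C_mul (c : ℂ) (s : LaurentSeries (SLEData p₀)) :
    c • s = HahnSeries.C (algebraMap ℂ (SLEData p₀) c) * s := by
  ext n
  rw [HahnSeries.coeff_smul, HahnSeries.C_apply, HahnSeries.coeff_single_zero_mul,
    Algebra.smul_def]

theorem dF_neg (b : ℕ → SLEData p₀) (η : SLEData p₀) : dF (fun k => -b k) η = -dF b η := by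
  have h : dFDer (fun k => -b k) = -dFDer b := by
    refine derivation_ext (fun φ => ?_) fun k => ?_
    · exact (dF_const _ φ).trans (neg_eq_zero.2 (dF_const b φ)).symm
    · exact (dF_fVar _ k).trans (congrArg _ (dF_fVar b k).symm)
  exact congrArg (fun E : Derivation ℂ _ _ => E η) h

theorem virL_apply (c : ℂ) (δ : Fin N ⊕ Fin M → ℂ) (n : ℤ) (η : SLEData p₀) :
    virL hp₀ c δ n η = virDer hp₀ n η + virWeight p₀ c δ n * η := by
  have h2 (i : Fin N ⊕ Fin M) : (derivative (vPoly (fVar p₀) n)).eval (pt p₀ i)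
      = res (upow _ (1 - n) * (ddu (fGen p₀) ^ 2 * fGenInv p₀ i ^ 2)) :=
    eval_derivative_vPoly (dXDer_fVar hp₀ i) (dXDer_pt_self hp₀ i) n
  have h1 (i : Fin N ⊕ Fin M) : (vPoly (fVar p₀) n).eval (pt p₀ i)
      = res (upow _ (1 - n) * (ddu (fGen p₀) ^ 2 * fGenInv p₀ i)) :=
    eval_vPoly (fVar p₀) n (pt p₀ i)
  have h3 : res (upow (SLEData p₀) (1 - n) * ((c / 12) • schwarzian (fGen p₀)))
      = algebraMap ℂ _ (c / 12) * res (upow _ (1 - n) * schwarzian (fSeries (fVar p₀))) := by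
    rw [smul_eq_C_mul, ← res_const_mul, fGen]
    congr 1
    ring
  have hsm (r : ℂ) (ξ : SLEData p₀) : r • ξ = algebraMap ℂ (SLEData p₀) r * ξ :=
    Algebra.smul_def _ _
  rw [virL, virDer, vectorField_apply, virWeight]
  simp only [h1, h2, coeff_vRem, dF_neg, LinearMap.add_apply, LinearMap.sub_apply,
    LinearMap.sum_apply, LinearMap.smul_apply, Module.End.mul_apply, mulOp_apply, h3,
    Finset.sum_add_distrib, add_mul, Finset.sum_mul, hsm]
  simp only [fGen, mul_assoc]
  ring

theorem onCoeff_virDer (n : ℤ) :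
    onCoeff (virDer hp₀ n) (fSeries (fVar p₀)) = vRem (fVar p₀) n :=
  onCoeff_fSeries_eq (vanishesBelow_vRem _ n) fun k => vectorField_fVar hp₀ _ _ k

theorem virDer_pt (n : ℤ) (i : Fin N ⊕ Fin M) :
    virDer hp₀ n (pt p₀ i) = (vPoly (fVar p₀) n).eval (pt p₀ i) :=
  vectorField_coord hp₀ _ _ i

theorem virDer_bracket (n m : ℤ) :
    ⁅virDer hp₀ n, virDer hp₀ m⁆ = ((n : SLEData p₀) - m) • virDer hp₀ (n + m) := by
  refine (vectorField_bracket hp₀ _ _ _ _).trans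
    (Eq.trans ?_ (vectorField_smul hp₀ _ _ _).symm)
  refine vectorField_congr hp₀ (fun i => ?_) fun k => ?_
  · exact apply_eval_vPoly_sub (onCoeff_virDer hp₀ n) (onCoeff_virDer hp₀ m) (virDer_pt hp₀ n i)
      (virDer_pt hp₀ m i)
  · have h := congrArg (fun s : LaurentSeries (SLEData p₀) => s.coeff (k + 1))
      (onCoeff_vRem_sub_eq (onCoeff_virDer hp₀ n) (onCoeff_virDer hp₀ m))
    simp only [HahnSeries.coeff_sub, coeff_onCoeff, HahnSeries.C_apply,
      HahnSeries.coeff_single_zero_mul] at h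
    exact h

/-- The divergence terms v_n'(p_i) form a cocycle without central term for every choice of weights;
the central term comes from the Schwarzian alone. -/
theorem virWeight_sub (c : ℂ) (δ : Fin N ⊕ Fin M → ℂ) (n m : ℤ) :
    virDer hp₀ n (virWeight p₀ c δ m) - virDer hp₀ m (virWeight p₀ c δ n)
      = ((n : SLEData p₀) - m) * virWeight p₀ c δ (n + m)
        + algebraMap ℂ _ (if n + m = 0 then c / 12 * ((n : ℂ) ^ 3 - n) else 0) := by
  have h1 := apply_res_schwarzian_sub (onCoeff_virDer hp₀ n) (onCoeff_virDer hp₀ m)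
  have h2 (i : Fin N ⊕ Fin M) := apply_eval_derivative_vPoly_sub (onCoeff_virDer hp₀ n)
    (onCoeff_virDer hp₀ m) (virDer_pt hp₀ n i) (virDer_pt hp₀ m i)
  have h3 : algebraMap ℂ (SLEData p₀) (if n + m = 0 then c / 12 * ((n : ℂ) ^ 3 - n) else 0)
      = algebraMap ℂ _ (c / 12) * if n + m = 0 then (n : SLEData p₀) ^ 3 - n else 0 := by
    split_ifs
    · rw [map_mul, map_sub, map_pow, map_intCast]
    · rw [map_zero, mul_zero]
  rw [h3, virWeight, virWeight, virWeight]
  simp only [map_add, map_sum, Derivation.leibniz, Derivation.map_algebraMap, mul_zero, add_zero,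
    smul_eq_mul]
  rw [add_sub_add_comm, ← Finset.sum_sub_distrib, ← mul_sub, h1]
  simp only [← mul_sub, h2, mul_add, Finset.mul_sum]
  have h4 : ∑ i, algebraMap ℂ (SLEData p₀) (δ i) * (((n : SLEData p₀) - m)
        * (derivative (vPoly (fVar p₀) (n + m))).eval (pt p₀ i))
      = ∑ i, ((n : SLEData p₀) - m) * (algebraMap ℂ (SLEData p₀) (δ i)
        * (derivative (vPoly (fVar p₀) (n + m))).eval (pt p₀ i)) :=
    Finset.sum_congr rfl fun i _ => by ring
  rw [h4]
  ring

theorem isVirasoroRep_virL (c : ℂ) (δ : Fin N ⊕ Fin M → ℂ) :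
    IsVirasoroRep c (virL hp₀ c δ) := by
  intro n m
  refine LinearMap.ext fun η => ?_
  have h1 := congrArg (fun E : Derivation ℂ _ _ => E η) (virDer_bracket hp₀ n m)
  have h2 := virWeight_sub hp₀ c δ n m
  have h3 : algebraMap ℂ (SLEData p₀) ((n : ℂ) - m) = (n : SLEData p₀) - m := by
    rw [map_sub, map_intCast, map_intCast]
  simp only [Derivation.commutator_apply, Derivation.smul_apply, smul_eq_mul] at h1
  have hsm (r : ℂ) (ξ : SLEData p₀) : r • ξ = algebraMap ℂ (SLEData p₀) r * ξ :=
    Algebra.smul_def _ _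
  rw [Ring.lie_def]
  simp only [LinearMap.sub_apply, LinearMap.add_apply, LinearMap.smul_apply, Module.End.mul_apply,
    virL_apply, Module.End.one_apply]
  simp only [hsm, map_add, Derivation.leibniz, smul_eq_mul, h3]
  linear_combination h1 + η * h2

variable (I : Fin N)

/-- The coefficients of the first order part of `𝒜_I` other than `∂/∂x_I`. -/
def driftInv (i : Fin N ⊕ Fin M) : SLEData p₀ :=
  if i = Sum.inl I then 0 else const (invDiff hp₀ (Sum.inl I) i)

/-- The first order part of `𝒜_I`. -/
def driftDer : Derivation ℂ (SLEData p₀) (SLEData p₀) :=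
  vectorField hp₀ (fun i => 2 * driftInv hp₀ I i)
    (fun k => 2 * res (upow (SLEData p₀) (k : ℤ) * fGenInv p₀ (Sum.inl I)))

/-- The part of order zero of `𝒜_I`. -/
def driftWeight (δ : Fin N ⊕ Fin M → ℂ) : SLEData p₀ :=
  ∑ i, algebraMap ℂ _ (δ i) * (-2 * driftInv hp₀ I i ^ 2)

theorem driftInv_self : driftInv hp₀ I (Sum.inl I) = 0 := if_pos rfl

/-- Since (κ_J - 6)/κ_J = -2h_{x_J}, the points x_J and y_K enter in the same way. The convention
that `driftInv` is 0 at x_I allows sums over all points. -/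
theorem driftA_apply {κs : Fin N → ℝ} {hy : Fin M → ℝ} {δ : Fin N ⊕ Fin M → ℂ}
    (hκ : ∀ J, κs J ≠ 0) (hδ : ∀ J, δ (Sum.inl J) = weightX (κs J))
    (hδ' : ∀ K, δ (Sum.inr K) = hy K) (η : SLEData p₀) :
    driftA hp₀ κs hy I η = ((κs I / 2 : ℝ) : ℂ) • dXDer hp₀ (Sum.inl I) (dXDer hp₀ (Sum.inl I) η)
      + driftDer hp₀ I η + driftWeight hp₀ I δ * η := by
  have hF : (2 : ℂ) • dF (fun k => res (upow (SLEData p₀) (k : ℤ) * fGenInv p₀ (Sum.inl I))) η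
      = dF (fun k => 2 * res (upow (SLEData p₀) (k : ℤ) * fGenInv p₀ (Sum.inl I))) η := by
    set b : ℕ → SLEData p₀ := fun k => res (upow (SLEData p₀) (k : ℤ) * fGenInv p₀ (Sum.inl I))
    have h : dFDer (fun k => 2 * b k) = (2 : ℂ) • dFDer b := by
      refine derivation_ext (fun φ => ?_) fun k => ?_
      · refine (dF_const _ φ).trans ?_
        rw [Derivation.smul_apply, show dFDer b (const φ) = 0 from dF_const b φ, smul_zero]
      · refine (dF_fVar _ k).trans ?_
        rw [Derivation.smul_apply, show dFDer b (fVar p₀ k) = b k from dF_fVar b k,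
          Algebra.smul_def, map_ofNat]
    exact (congrArg (fun E : Derivation ℂ _ _ => E η) h).symm
  have hJ (J : Fin N) : algebraMap ℂ (SLEData p₀) (((κs J - 6) / κs J : ℝ) : ℂ)
      = -2 * algebraMap ℂ _ (δ (Sum.inl J)) := by
    rw [hδ, ← map_ofNat (algebraMap ℂ (SLEData p₀)) 2, ← map_neg, ← map_mul, weightX]
    congr 1
    have := hκ J
    push_cast
    have h' : (κs J : ℂ) ≠ 0 := by exact_mod_cast this
    field_simp
    ring
  have hK (K : Fin M) : algebraMap ℂ (SLEData p₀) ((2 * hy K : ℝ) : ℂ)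
      = 2 * algebraMap ℂ _ (δ (Sum.inr K)) := by
    rw [hδ', ← map_ofNat (algebraMap ℂ (SLEData p₀)) 2, ← map_mul]
    push_cast
    rfl
  have hsm (r : ℂ) (ξ : SLEData p₀) : r • ξ = algebraMap ℂ (SLEData p₀) r * ξ :=
    Algebra.smul_def _ _
  have e1 : ∑ J ∈ Finset.univ.erase I, (const (2 * invDiff hp₀ (Sum.inl I) (Sum.inl J))
        * dX hp₀ (Sum.inl J) η + algebraMap ℂ (SLEData p₀) (((κs J - 6) / κs J : ℝ) : ℂ)
          * (const (invDiff hp₀ (Sum.inl I) (Sum.inl J) ^ 2) * η))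
      = ∑ J, (2 * driftInv hp₀ I (Sum.inl J) * dX hp₀ (Sum.inl J) η
        + algebraMap ℂ _ (δ (Sum.inl J)) * (-2 * driftInv hp₀ I (Sum.inl J) ^ 2) * η) := by
    rw [← Finset.sum_erase Finset.univ (a := I) (by rw [driftInv_self]; ring)]
    refine Finset.sum_congr rfl fun J hJI => ?_
    have hne : (Sum.inl J : Fin N ⊕ Fin M) ≠ Sum.inl I :=
      fun h => (Finset.mem_erase.1 hJI).1 (Sum.inl_injective h)
    rw [hJ, driftInv, if_neg hne, const_mul, const_pow, const_two]
    ring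
  have e2 : ∑ K, (const (2 * invDiff hp₀ (Sum.inl I) (Sum.inr K))
        * dX hp₀ (Sum.inr K) η - algebraMap ℂ (SLEData p₀) ((2 * hy K : ℝ) : ℂ)
          * (const (invDiff hp₀ (Sum.inl I) (Sum.inr K) ^ 2) * η))
      = ∑ K, (2 * driftInv hp₀ I (Sum.inr K) * dX hp₀ (Sum.inr K) η
        + algebraMap ℂ _ (δ (Sum.inr K)) * (-2 * driftInv hp₀ I (Sum.inr K) ^ 2) * η) := by
    refine Finset.sum_congr rfl fun K _ => ?_
    rw [hK, driftInv, if_neg Sum.inr_ne_inl, const_mul, const_pow, const_two]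
    ring
  rw [driftA, nullD, driftDer, vectorField_apply, driftWeight, Fintype.sum_sum_type,
    Fintype.sum_sum_type, ← hF, pow_two]
  simp only [LinearMap.add_apply, LinearMap.sub_apply, LinearMap.sum_apply, LinearMap.smul_apply,
    Module.End.mul_apply, mulOp_apply, dXDer_apply, hsm]
  rw [e1, e2, Finset.sum_add_distrib, Finset.sum_add_distrib, add_mul, Finset.sum_mul,
    Finset.sum_mul]
  ring

theorem driftDer_pt (i : Fin N ⊕ Fin M) : driftDer hp₀ I (pt p₀ i) = 2 * driftInv hp₀ I i :=
  vectorField_coord hp₀ _ _ i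

theorem driftInv_mul {i : Fin N ⊕ Fin M} (hi : i ≠ Sum.inl I) :
    driftInv hp₀ I i * (pt p₀ i - pt p₀ (Sum.inl I)) = 1 := by
  rw [driftInv, if_neg hi, pt, pt, ← const_sub, ← const_mul, invDiff_mul hp₀ hi.symm, const_one]

theorem driftDer_pt_self : driftDer hp₀ I (pt p₀ (Sum.inl I)) = 0 := by
  rw [driftDer_pt, driftInv_self, mul_zero]

theorem onCoeff_driftDer :
    onCoeff (driftDer hp₀ I) (fSeries (fVar p₀)) = 2 * fInv (fVar p₀) (pt p₀ (Sum.inl I)) := by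
  have h2 : VanishesBelow 1 (2 * fInv (fVar p₀) (pt p₀ (Sum.inl I))) := by
    rw [two_mul]
    exact (vanishesBelow_fInv _ _).add (vanishesBelow_fInv _ _)
  refine onCoeff_fSeries_eq h2 fun k => (vectorField_fVar hp₀ _ _ k).trans ?_
  rw [res_upow_mul, two_mul, two_mul, HahnSeries.coeff_add]
  rfl

theorem virDer_dXDer_bracket (n : ℤ) :
    ⁅virDer hp₀ n, dXDer hp₀ (Sum.inl I)⁆
      = -((derivative (vPoly (fVar p₀) n)).eval (pt p₀ (Sum.inl I)) • dXDer hp₀ (Sum.inl I)) := by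
  have e := dXDer_eq_vectorField hp₀ (Sum.inl I)
  have hz : onCoeff (dXDer hp₀ (Sum.inl I)) (vRem (fVar p₀) n) = 0 := by
    rw [onCoeff_vRem, polyD_vPoly_of_eq_zero (dXDer_fVar hp₀ _),
      onCoeff_fSeries_of_eq_zero (dXDer_fVar hp₀ _), polyF_zero, ddu_zero]
    ring
  rw [← neg_smul, e, vectorField_smul]
  refine (vectorField_bracket hp₀ _ _ _ _).trans (vectorField_congr hp₀ (fun i => ?_) fun k => ?_)
  · change virDer hp₀ n _ - _ = _
    rw [← e, apply_eval_vPoly_of_eq_zero (dXDer_fVar hp₀ _), dXDer_apply, dX_pt]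
    by_cases h : i = Sum.inl I
    · subst h
      rw [Pi.single_eq_same, Derivation.map_one_eq_zero, if_pos rfl]
      ring
    · rw [Pi.single_eq_of_ne h, map_zero, if_neg (Ne.symm h)]
      ring
  · have h := congrArg (fun s : LaurentSeries (SLEData p₀) => s.coeff (k + 1)) hz
    simp only [coeff_onCoeff] at h
    rw [← e, h, Pi.zero_apply, map_zero, mul_zero, HahnSeries.coeff_zero, sub_zero]

/-- The extra multiple of ∂/∂x_I is the x_I-component of the bracket: W has none of its own, so only
-W(v_n(x_I)) = 3v_n''(x_I) is left there. -/
theorem virDer_driftDer_bracket (n : ℤ) :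
    ⁅virDer hp₀ n, driftDer hp₀ I⁆
      = (-2 * (derivative (vPoly (fVar p₀) n)).eval (pt p₀ (Sum.inl I))) • driftDer hp₀ I
        + (3 * (derivative (derivative (vPoly (fVar p₀) n))).eval (pt p₀ (Sum.inl I)))
          • dXDer hp₀ (Sum.inl I) := by
  have hD := onCoeff_virDer hp₀ n
  have hW := onCoeff_driftDer hp₀ I
  have hDx := virDer_pt hp₀ n (Sum.inl I)
  rw [dXDer_eq_vectorField, vectorField_smul]
  refine (vectorField_bracket hp₀ _ _ _ _).trans (Eq.trans ?_ ((congrArg (· + _)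
    (vectorField_smul hp₀ _ _ _)).trans (vectorField_add hp₀ _ _ _ _)).symm)
  refine vectorField_congr hp₀ (fun i => ?_) fun k => ?_
  · change virDer hp₀ n _ - driftDer hp₀ I _ = _
    by_cases h : i = Sum.inl I
    · subst h
      rw [driftInv_self, mul_zero, map_zero, Pi.single_eq_same,
        apply_eval_vPoly_of_loewner hD hDx hW (driftDer_pt_self hp₀ I)]
      ring
    · rw [Pi.single_eq_of_ne h, mul_zero, add_zero]
      exact apply_loewner_sub hD hDx hW (driftInv_mul hp₀ I h)
        (virDer_pt hp₀ n i) (driftDer_pt hp₀ I i)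
  · change virDer hp₀ n _ - driftDer hp₀ I _ = _
    have h := congrArg (fun s : LaurentSeries (SLEData p₀) => s.coeff (k + 1))
      (onCoeff_loewner_sub hD hDx hW)
    have h2 : (2 * fInv (fVar p₀) (pt p₀ (Sum.inl I))).coeff ((k : ℤ) + 1)
        = 2 * res (upow (SLEData p₀) (k : ℤ) * fGenInv p₀ (Sum.inl I)) := by
      rw [res_upow_mul, two_mul, two_mul, HahnSeries.coeff_add]
      rfl
    simp only [HahnSeries.coeff_sub, coeff_onCoeff, HahnSeries.C_apply,
      HahnSeries.coeff_single_zero_mul, h2] at h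
    rw [h, Pi.zero_apply, mul_zero, add_zero]

/-- Points other than x_I contribute exactly the right side. What remains is a multiple of
v_n'''(x_I), with factor (4/3)h from the weight at x_I, c/6 from the Schwarzian and -sh from the
second order term. The sum is zero precisely under the assumed relation between c, s and h. -/
theorem virDer_driftWeight_sub (c : ℂ) (δ : Fin N ⊕ Fin M → ℂ) (n : ℤ) {s : ℂ}
    (hc : c = δ (Sum.inl I) * (6 * s - 8)) :
    virDer hp₀ n (driftWeight hp₀ I δ) - driftDer hp₀ I (virWeight p₀ c δ n)
      - algebraMap ℂ _ s * (algebraMap ℂ _ (δ (Sum.inl I)) * (derivative (derivative (derivative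
        (vPoly (fVar p₀) n)))).eval (pt p₀ (Sum.inl I)))
      = -2 * (derivative (vPoly (fVar p₀) n)).eval (pt p₀ (Sum.inl I)) * driftWeight hp₀ I δ := by
  have hD := onCoeff_virDer hp₀ n
  have hW := onCoeff_driftDer hp₀ I
  have hDx := virDer_pt hp₀ n (Sum.inl I)
  have hi (i : Fin N ⊕ Fin M) : virDer hp₀ n (-2 * driftInv hp₀ I i ^ 2)
      - driftDer hp₀ I ((derivative (vPoly (fVar p₀) n)).eval (pt p₀ i))
      = -2 * (derivative (vPoly (fVar p₀) n)).eval (pt p₀ (Sum.inl I))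
          * (-2 * driftInv hp₀ I i ^ 2)
        -- At x_I the drift weight is 0 by convention, so W(v_n'(x_I)) is left uncompensated and is
        -- kept as a correction.
        - if i = Sum.inl I then
          driftDer hp₀ I ((derivative (vPoly (fVar p₀) n)).eval (pt p₀ (Sum.inl I))) else 0 := by
    by_cases h : i = Sum.inl I
    · subst h
      rw [if_pos rfl, driftInv_self, zero_pow two_ne_zero, mul_zero, map_zero, mul_zero]
    · rw [if_neg h, sub_zero]
      exact apply_weight_loewner_sub hD hDx hW (driftInv_mul hp₀ I h) (virDer_pt hp₀ n i)
        (driftDer_pt hp₀ I i)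
  have hS := apply_res_schwarzian_of_loewner (n := n) hW
  have h3 := eval_derivative_derivative_derivative_vPoly (dXDer_fVar hp₀ (Sum.inl I))
    (dXDer_pt_self hp₀ (Sum.inl I)) n
  have h4 := apply_eval_derivative_vPoly_of_loewner hD hDx hW (driftDer_pt_self hp₀ I)
  have hsum : ∑ i, algebraMap ℂ (SLEData p₀) (δ i) * (virDer hp₀ n (-2 * driftInv hp₀ I i ^ 2)
        - driftDer hp₀ I ((derivative (vPoly (fVar p₀) n)).eval (pt p₀ i)))
      = -2 * (derivative (vPoly (fVar p₀) n)).eval (pt p₀ (Sum.inl I)) * driftWeight hp₀ I δ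
        - algebraMap ℂ _ (δ (Sum.inl I)) *
          driftDer hp₀ I ((derivative (vPoly (fVar p₀) n)).eval (pt p₀ (Sum.inl I))) := by
    rw [driftWeight, Finset.mul_sum, ← Fintype.sum_ite_eq' (Sum.inl I : Fin N ⊕ Fin M) fun _ =>
        algebraMap ℂ (SLEData p₀) (δ (Sum.inl I)) * driftDer hp₀ I
          ((derivative (vPoly (fVar p₀) n)).eval (pt p₀ (Sum.inl I))), ← Finset.sum_sub_distrib]
    refine Finset.sum_congr rfl fun i _ => ?_
    rw [hi]
    split_ifs with h
    · rw [h]; ring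
    · ring
  have hc12 : 12 * algebraMap ℂ (SLEData p₀) (c / 12)
      = algebraMap ℂ _ (δ (Sum.inl I)) * (6 * algebraMap ℂ _ s - 8) := by
    rw [← map_ofNat (algebraMap ℂ (SLEData p₀)) 12, ← map_ofNat (algebraMap ℂ (SLEData p₀)) 6,
      ← map_ofNat (algebraMap ℂ (SLEData p₀)) 8, ← map_mul, ← map_mul, ← map_sub, ← map_mul, ← hc]
    congr 1
    ring
  have h3i : 3 * algebraMap ℂ (SLEData p₀) (1 / 3) = 1 := by
    rw [← map_ofNat (algebraMap ℂ (SLEData p₀)) 3, ← map_mul, ← map_one (algebraMap ℂ (SLEData p₀))]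
    congr 1
    norm_num
  have hDm : virDer hp₀ n (driftWeight hp₀ I δ)
      = ∑ i, algebraMap ℂ (SLEData p₀) (δ i) * virDer hp₀ n (-2 * driftInv hp₀ I i ^ 2) := by
    rw [driftWeight, map_sum]
    refine Finset.sum_congr rfl fun i _ => ?_
    rw [Derivation.leibniz, Derivation.map_algebraMap, smul_zero, add_zero, smul_eq_mul]
  have hWρ : driftDer hp₀ I (virWeight p₀ c δ n)
      = algebraMap ℂ _ (c / 12) * driftDer hp₀ I
          (res (upow _ (1 - n) * schwarzian (fSeries (fVar p₀))))
        + ∑ i, algebraMap ℂ (SLEData p₀) (δ i)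
          * driftDer hp₀ I ((derivative (vPoly (fVar p₀) n)).eval (pt p₀ i)) := by
    rw [virWeight, map_add, map_sum, Derivation.leibniz, Derivation.map_algebraMap, smul_zero,
      add_zero, smul_eq_mul]
    congr 1
    refine Finset.sum_congr rfl fun i _ => ?_
    rw [Derivation.leibniz, Derivation.map_algebraMap, smul_zero, add_zero, smul_eq_mul]
  have hsub : virDer hp₀ n (driftWeight hp₀ I δ) - driftDer hp₀ I (virWeight p₀ c δ n)
      = ∑ i, algebraMap ℂ (SLEData p₀) (δ i) * (virDer hp₀ n (-2 * driftInv hp₀ I i ^ 2)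
        - driftDer hp₀ I ((derivative (vPoly (fVar p₀) n)).eval (pt p₀ i)))
        - algebraMap ℂ _ (c / 12) * driftDer hp₀ I
          (res (upow _ (1 - n) * schwarzian (fSeries (fVar p₀)))) := by
    rw [hDm, hWρ, ← sub_sub, sub_right_comm, ← Finset.sum_sub_distrib]
    congr 1
    exact Finset.sum_congr rfl fun i _ => (mul_sub _ _ _).symm
  rw [hsub, hsum, hS]
  generalize res (upow (SLEData p₀) (1 - n) * (ddu (fSeries (fVar p₀)) ^ 2
    * fInv (fVar p₀) (pt p₀ (Sum.inl I)) ^ 4)) = r at h3 ⊢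
  rw [h3] at h4 ⊢
  linear_combination r * hc12 - algebraMap ℂ (SLEData p₀) (1 / 3)
      * algebraMap ℂ (SLEData p₀) (δ (Sum.inl I)) * h4
    + algebraMap ℂ (SLEData p₀) (δ (Sum.inl I)) * (driftDer hp₀ I
      ((derivative (vPoly (fVar p₀) n)).eval (pt p₀ (Sum.inl I))) + 8 * r) * h3i

/-- The main commutation relation. -/
theorem virL_driftA_commutator {κs : Fin N → ℝ} {hy : Fin M → ℝ} {c : ℂ}
    {δ : Fin N ⊕ Fin M → ℂ} (hκ : ∀ J, κs J ≠ 0) (hδ : ∀ J, δ (Sum.inl J) = weightX (κs J))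
    (hδ' : ∀ K, δ (Sum.inr K) = hy K) (hc : c = centralCharge (κs I)) (n : ℤ) :
    ⁅virL hp₀ c δ n, driftA hp₀ κs hy I⁆
      = mulOp (evalAt p₀ I (qPoly n)) * driftA hp₀ κs hy I := by
  set P := dXDer hp₀ (Sum.inl I)
  have hP0 := dXDer_fVar hp₀ (Sum.inl I)
  have hP1 := dXDer_pt_self hp₀ (Sum.inl I)
  have hκI : (κs I : ℂ) ≠ 0 := by exact_mod_cast hκ I
  have hq : evalAt p₀ I (qPoly n)
      = -2 * (derivative (vPoly (fVar p₀) n)).eval (pt p₀ (Sum.inl I)) := by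
    rw [evalAt_qPoly, eval_derivative_vPoly hP0 hP1]
    rfl
  have hv₁ := apply_eval_derivative_vPoly_of_eq_zero hP0 n
  have hv₂ := apply_eval_derivative_derivative_vPoly_of_eq_zero hP0 n (pt p₀ (Sum.inl I))
  rw [hP1, mul_one] at hv₂
  have hS : onCoeff P (schwarzian (fSeries (fVar p₀))) = 0 := by
    rw [onCoeff_schwarzian, onCoeff_fSeries_of_eq_zero hP0, zero_mul, bol, ddu_zero]
    simp [ddu_zero]
  have hρ : P (virWeight p₀ c δ n) = algebraMap ℂ _ (δ (Sum.inl I))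
      * (derivative (derivative (vPoly (fVar p₀) n))).eval (pt p₀ (Sum.inl I)) := by
    rw [virWeight, map_add, map_sum, Derivation.leibniz, Derivation.map_algebraMap, smul_zero,
      add_zero, ← res_onCoeff, onCoeff_mul, hS, onCoeff_upow, mul_zero, mul_zero, add_zero,
      res_zero, smul_zero, zero_add, Finset.sum_eq_single (Sum.inl I)]
    · rw [Derivation.leibniz, Derivation.map_algebraMap, smul_zero, add_zero, smul_eq_mul, hv₁, hP1,
        mul_one]
    · intro j _ hj
      rw [Derivation.leibniz, Derivation.map_algebraMap, smul_zero, add_zero, smul_eq_mul, hv₁,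
        dXDer_apply, dX_pt, if_neg (Ne.symm hj), mul_zero, mul_zero]
    · simp
  have hv₁' := hv₁ (pt p₀ (Sum.inl I))
  rw [hP1, mul_one] at hv₁'
  -- The degeneracy condition at level two: 1 + 2h_{x_I} = 6/κ_I.
  have hs : algebraMap ℂ (SLEData p₀) ((κs I / 2 : ℝ) : ℂ)
      * (1 + 2 * algebraMap ℂ _ (δ (Sum.inl I))) = 3 := by
    rw [hδ, ← map_ofNat (algebraMap ℂ (SLEData p₀)) 2, ← map_ofNat (algebraMap ℂ (SLEData p₀)) 3,
      ← map_mul, ← map_one (algebraMap ℂ (SLEData p₀)), ← map_add, ← map_mul, weightX]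
    congr 1
    push_cast
    field_simp
    ring
  have hc' : c = δ (Sum.inl I) * (6 * ((κs I / 2 : ℝ) : ℂ) - 8) := by
    rw [hc, hδ, centralCharge, weightX]
    push_cast
    field_simp
    ring
  refine LinearMap.ext fun η => ?_
  rw [Ring.lie_def]
  simp only [LinearMap.sub_apply, Module.End.mul_apply, mulOp_apply, virL_apply,
    driftA_apply hp₀ I hκ hδ hδ', hq]
  exact commutator_eq_mul (virDer_dXDer_bracket hp₀ I n) (virDer_driftDer_bracket hp₀ I n) hρ
    (Derivation.map_algebraMap _ _) hv₁' hv₂ hs (virDer_driftWeight_sub hp₀ I c δ n hc') η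

/-- The central charge is 13 - (3/2)(κ + 16/κ), which is symmetric under κ ↦ 16/κ. -/
theorem centralCharge_of_dual {κ κ' : ℝ} (hκ : 0 < κ) (h : κ' = κ ∨ κ' = 16 / κ) :
    centralCharge κ' = centralCharge κ := by
  rcases h with rfl | rfl
  · rfl
  · rw [centralCharge, centralCharge]
    field_simp
    ring

end Operators

end

end SLE

/-! ### The main theorem -/

theorem corollary4p5 :
    ∃ q : ℤ → MvPolynomial (Option ℕ) ℂ,
      (∀ n : ℤ, MvPolynomial.IsWeightedHomogeneous SLE.varDegree (q n) (-n)) ∧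
      (∀ n : ℤ, 0 < n → q n = 0) ∧
      ∀ (N M : ℕ) (p₀ : Fin N ⊕ Fin M → ℝ) (hp₀ : Function.Injective p₀)
        (κ : ℝ) (_ : 0 < κ)
        (κs : Fin N → ℝ) (_ : ∀ I, κs I = κ ∨ κs I = 16 / κ)
        (hy : Fin M → ℝ)
        (c : ℂ) (_ : c = SLE.centralCharge κ)
        (δ : Fin N ⊕ Fin M → ℂ)
        (_ : ∀ I, δ (Sum.inl I) = SLE.weightX (κs I))
        (_ : ∀ K, δ (Sum.inr K) = hy K),
        (∀ (n : ℤ) (I : Fin N),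
          ⁅SLE.virL hp₀ c δ n, SLE.driftA hp₀ κs hy I⁆ =
            SLE.mulOp (SLE.evalAt p₀ I (q n)) * SLE.driftA hp₀ κs hy I) ∧
        (∀ (n : ℤ) (I : Fin N) (η : SLE.SLEData p₀),
          SLE.driftA hp₀ κs hy I η = 0 →
            SLE.driftA hp₀ κs hy I (SLE.virL hp₀ c δ n η) = 0) ∧
        SLE.IsVirasoroRep c (SLE.virL hp₀ c δ) ∧
        (∀ (n : ℤ), ∀ η ∈ ⨅ I : Fin N, LinearMap.ker (SLE.driftA hp₀ κs hy I),
          SLE.virL hp₀ c δ n η ∈ ⨅ I : Fin N, LinearMap.ker (SLE.driftA hp₀ κs hy I)) := by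
  refine ⟨SLE.qPoly, SLE.isWeightedHomogeneous_qPoly, fun n hn => SLE.qPoly_eq_zero hn, ?_⟩
  intro N M p₀ hp₀ κ hκ κs hκs hy c hc δ hδ hδ'
  have hne (J : Fin N) : κs J ≠ 0 := by
    rcases hκs J with h | h
    · rw [h]; exact hκ.ne'
    · rw [h]; exact div_ne_zero (by norm_num) hκ.ne'
  have hcomm (n : ℤ) (I : Fin N) := SLE.virL_driftA_commutator hp₀ I hne hδ hδ'
    (by rw [hc, SLE.centralCharge_of_dual hκ (hκs I)] : c = SLE.centralCharge (κs I)) n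
  have hker (n : ℤ) (I : Fin N) (η : SLE.SLEData p₀) (hη : SLE.driftA hp₀ κs hy I η = 0) :
      SLE.driftA hp₀ κs hy I (SLE.virL hp₀ c δ n η) = 0 := by
    have h := congrArg (fun E : Module.End ℂ (SLE.SLEData p₀) => E η) (hcomm n I)
    simp only [Ring.lie_def, LinearMap.sub_apply, Module.End.mul_apply, hη, map_zero, zero_sub,
      neg_eq_zero] at h
    exact h
  refine ⟨hcomm, hker, SLE.isVirasoroRep_virL hp₀ c δ, fun n η hη => ?_⟩
  simp only [Submodule.mem_iInf, LinearMap.mem_ker] at hη ⊢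
  exact fun I => hker n I η (hη I)
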